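/- Let $F$ be a global field, that is, a finite extension of $\mathbb{Q}$ or of $\mathbb{F}_p(t)$ for some prime $p$, and let $\mathfrak{o}_F$ be its ring of integers (the integral closure in $F$ of $\mathbb{Z}$, respectively of $\mathbb{F}_p[t]$). Let $\varphi \in F(x)$ be a rational map of degree at least $2$, acting on $\mathbb{P}^1$, and write $\varphi^n$ for its $n$-th iterate, $n \ge 0$. Let $\alpha, \beta \in F$, regarded as points of $\mathbb{P}^1(F)$, be such that - $\alpha$ is wandering, i.e. its forward orbit $\{\varphi^n(\alpha) : n \ge 0\}$ is infinite; - $\beta$ is periodic, i.e. $\varphi^k(\beta) = \beta$ for some $k \ge 1$; - $\beta$ is not exceptional, i.e. its back orbit $\{\gamma \in \mathbb{P}^1(\overline{F}) : \varphi^n(\gamma) = \beta \text{ for some } n \ge 1\}$ is infinite, where $\overline{F}$ is an algebraic closure of $F$. Then there are infinitely many nonzero prime ideals $\mathfrak{p}$ of $\mathfrak{o}_F$ such that $\varphi^n(\alpha) \equiv \beta \bmod \mathfrak{p}$ for some $n \ge 0$. Here the congruence means that the two points have the same image under the reduction map $\mathbb{P}^1(F) \to \mathbb{P}^1(\mathfrak{f}_{\mathfrak{p}})$,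 where $\mathfrak{f}_{\mathfrak{p}}$ is the residue field of $\mathfrak{p}$. -/

import Mathlib

open scoped LinearAlgebra.Projectivization

/-! ### Global fields -/

/-- `A` is (isomorphic to) `ℤ` or `𝔽_p[t]`. A global field is a finite extension `F` of the
fraction field `K` of such a ring `A`, that is a finite extension of `ℚ` or of `𝔽_p(t)`; its ring
of integers is the integral closure of `A` in `F`. -/
def IsGlobalBase (A : Type*) [CommRing A] : Prop :=
  Nonempty (A ≃+* ℤ) ∨ ∃ p : ℕ, p.Prime ∧ Nonempty (A ≃+* Polynomial (ZMod p))

/-! ### Rational maps on the projective line -/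

/-- The projective line over a field `L`; the point `[x : y]` is the class of `![x, y]`. -/
abbrev P1 (L : Type*) [Field L] : Type _ := ℙ L (Fin 2 → L)

/-- The affine point `[x : 1]`. -/
def P1.ofField {L : Type*} [Field L] (x : L) : P1 L :=
  Projectivization.mk L ![x, 1] (fun h => one_ne_zero (congrFun h 1))

namespace RationalMap

variable {F : Type*} [Field F] (φ : RatFunc F) (L : Type*) [Field L] [Algebra F L]

/-- The degree of a rational map: the maximum of the degrees of its numerator and denominator in
lowest terms. -/
noncomputable def degree : ℕ := max φ.num.natDegree φ.denom.natDegree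

/-- The pair of values `(φ₁(x, y), φ₂(x, y))`, where `φ₁`, `φ₂` are the forms of degree `deg φ`
which homogenize the numerator and the denominator of `φ`. -/
noncomputable def forms (v : Fin 2 → L) : Fin 2 → L :=
  ![MvPolynomial.aeval v (φ.num.homogenize (degree φ)),
    MvPolynomial.aeval v (φ.denom.homogenize (degree φ))]

variable {L}

theorem aeval_homogenize_smul (p : Polynomial F) (d : ℕ) (t : L) (v : Fin 2 → L) :
    MvPolynomial.aeval (t • v) (p.homogenize d) = t ^ d * MvPolynomial.aeval v (p.homogenize d) := by
  simp only [Polynomial.homogenize, map_sum, Finset.mul_sum]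
  refine Finset.sum_congr rfl fun kl hkl => ?_
  rw [← Finset.HasAntidiagonal.mem_antidiagonal.1 hkl, MvPolynomial.aeval_monomial, MvPolynomial.aeval_monomial,
    Finsupp.prod_fintype _ _ (by simp), Finsupp.prod_fintype _ _ (by simp)]
  simp [Fin.prod_univ_two, mul_pow, pow_add]
  ring

theorem aeval_homogenize_of_eq_zero (p : Polynomial F) (d : ℕ) (v : Fin 2 → L) (hv : v 1 = 0) :
    MvPolynomial.aeval v (p.homogenize d) = algebraMap F L (p.coeff d) * v 0 ^ d := by
  simp only [Polynomial.homogenize, map_sum]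
  rw [Finset.sum_eq_single (d, 0)]
  · rw [MvPolynomial.aeval_monomial, Finsupp.prod_fintype _ _ (by simp)]
    simp [Fin.prod_univ_two]
  · rintro ⟨k, l⟩ hkl hne
    have hl : l ≠ 0 := by
      rintro rfl
      exact hne (by simpa using hkl)
    rw [MvPolynomial.aeval_monomial, Finsupp.prod_fintype _ _ (by simp)]
    simp [Fin.prod_univ_two, hv, hl]
  · simp

theorem forms_smul (t : L) (v : Fin 2 → L) : forms φ L (t • v) = t ^ degree φ • forms φ L v := by
  simp [forms, aeval_homogenize_smul]

theorem forms_ne_zero (v : Fin 2 → L) (hv : v ≠ 0) : forms φ L v ≠ 0 := by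
  intro h
  have h0 : MvPolynomial.aeval v (φ.num.homogenize (degree φ)) = 0 := congrFun h 0
  have h1 : MvPolynomial.aeval v (φ.denom.homogenize (degree φ)) = 0 := congrFun h 1
  by_cases hv1 : v 1 = 0
  · have hv0 : v 0 ≠ 0 := fun h0' => hv (by ext i; fin_cases i <;> simpa)
    rw [aeval_homogenize_of_eq_zero _ _ _ hv1] at h0 h1
    have e0 : φ.num.coeff (degree φ) = 0 := by simpa [hv0] using h0
    have e1 : φ.denom.coeff (degree φ) = 0 := by simpa [hv0] using h1
    have hden := RatFunc.denom_ne_zero φ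
    rcases le_total φ.num.natDegree φ.denom.natDegree with hle | hle
    · rw [degree, max_eq_right hle] at e1
      exact hden (Polynomial.leadingCoeff_eq_zero.1 e1)
    · rw [degree, max_eq_left hle] at e0 e1
      have hnum := Polynomial.leadingCoeff_eq_zero.1 e0
      rw [hnum, Polynomial.natDegree_zero] at hle e1
      rw [← Nat.le_zero.1 hle] at e1
      exact hden (Polynomial.leadingCoeff_eq_zero.1 e1)
  · have hvt : v = v 1 • ![v 0 / v 1, 1] := by
      ext i
      fin_cases i
      · simp [mul_div_cancel₀ _ hv1]
      · simp
    rw [hvt, aeval_homogenize_smul] at h0 h1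
    have e0 := (mul_eq_zero.1 h0).resolve_left (pow_ne_zero _ (by simpa using hv1))
    have e1 := (mul_eq_zero.1 h1).resolve_left (pow_ne_zero _ (by simpa using hv1))
    rw [Polynomial.aeval_homogenize_of_eq_one
      (show φ.num.natDegree ≤ degree φ from le_max_left _ _) _ rfl] at e0
    rw [Polynomial.aeval_homogenize_of_eq_one
      (show φ.denom.natDegree ≤ degree φ from le_max_right _ _) _ rfl] at e1
    obtain ⟨a, b, hab⟩ := RatFunc.isCoprime_num_denom φ
    have := congrArg (Polynomial.aeval (![v 0 / v 1, 1] 0)) hab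
    simp only [map_add, map_mul, e0, e1, mul_zero, add_zero, map_one] at this
    exact zero_ne_one this

variable (L)

/-- The self-map `[x : y] ↦ [φ₁(x, y) : φ₂(x, y)]` of `ℙ¹(L)` given by `φ ∈ F(x)`, for a field
extension `L` of `F`. -/
noncomputable def map : P1 L → P1 L :=
  Projectivization.lift
    (fun v => Projectivization.mk L (forms φ L v.1) (forms_ne_zero φ v.1 v.2))
    (by
      rintro ⟨a, ha⟩ ⟨b, hb⟩ t h
      dsimp only at h
      subst h
      rw [Projectivization.mk_eq_mk_iff']
      exact ⟨t ^ degree φ, (forms_smul φ t b).symm⟩)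

variable {L}

/-- The forward orbit `{P, φ(P), φ²(P), …}`. -/
def forwardOrbit (P : P1 F) : Set (P1 F) := {Q | ∃ n : ℕ, (map φ F)^[n] P = Q}

/-- The back orbit of `x ∈ F`: the points of `ℙ¹` over an algebraic closure of `F` which some
iterate `φⁿ`, `n ≥ 1`, maps to `x`. -/
def backOrbit (x : F) : Set (P1 (AlgebraicClosure F)) :=
  {Q | ∃ n : ℕ, 1 ≤ n ∧
    (map φ (AlgebraicClosure F))^[n] Q = P1.ofField (algebraMap F (AlgebraicClosure F) x)}

/-- `x` is wandering: its forward orbit is infinite. -/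
def IsWandering (x : F) : Prop := (forwardOrbit φ (P1.ofField x)).Infinite

/-- `x` is exceptional: its back orbit is finite. -/
def IsExceptional (x : F) : Prop := (backOrbit φ x).Finite

/-- `x` is periodic: `φⁿ(x) = x` for some `n ≥ 1`. -/
def IsPeriodic (x : F) : Prop :=
  ∃ n : ℕ, 1 ≤ n ∧ (map φ F)^[n] (P1.ofField x) = P1.ofField x

end RationalMap

/-! ### Reduction modulo a prime -/

section Reduction

variable {R F : Type*} [CommRing R] [Field F] [Algebra R F] (𝔭 : Ideal R) [𝔭.IsPrime]

/-- `Q` is the reduction of `P ∈ ℙ¹(F)` modulo `𝔭`: there are coordinates `P = [a : b]` with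
`a`, `b` in `R`, not both in `𝔭`, and `Q = [a mod 𝔭 : b mod 𝔭]` over the residue field of `𝔭`. -/
def IsReduction (P : P1 F) (Q : P1 𝔭.ResidueField) : Prop :=
  ∃ (a : Fin 2 → R) (h : (fun i => algebraMap R F (a i)) ≠ 0)
    (h' : (fun i => algebraMap R 𝔭.ResidueField (a i)) ≠ 0),
    P = Projectivization.mk F _ h ∧ Q = Projectivization.mk 𝔭.ResidueField _ h'

/-- The reduction is unique. -/
theorem IsReduction.unique (hinj : Function.Injective (algebraMap R F)) {P : P1 F}
    {Q Q' : P1 𝔭.ResidueField} (hQ : IsReduction 𝔭 P Q) (hQ' : IsReduction 𝔭 P Q') : Q = Q' := by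
  obtain ⟨a, ha, ha', rfl, rfl⟩ := hQ
  obtain ⟨b, hb, hb', hP, rfl⟩ := hQ'
  rw [Projectivization.mk_eq_mk_iff'] at hP ⊢
  obtain ⟨t, ht⟩ := hP
  have e0 := congrFun ht 0
  have e1 := congrFun ht 1
  simp only [Pi.smul_apply, smul_eq_mul] at e0 e1
  have key : a 0 * b 1 = a 1 * b 0 := hinj (by rw [map_mul, map_mul, ← e0, ← e1]; ring)
  have key' := congrArg (algebraMap R 𝔭.ResidueField) key
  rw [map_mul, map_mul] at key'
  by_cases hb0 : algebraMap R 𝔭.ResidueField (b 0) = 0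
  · have hb1 : algebraMap R 𝔭.ResidueField (b 1) ≠ 0 := fun h1 =>
      hb' (by ext i; fin_cases i <;> assumption)
    refine ⟨algebraMap R 𝔭.ResidueField (a 1) / algebraMap R 𝔭.ResidueField (b 1), ?_⟩
    ext i
    fin_cases i
    · simp only [Fin.zero_eta, Pi.smul_apply, smul_eq_mul]
      field_simp
      linear_combination -key'
    · simp [div_mul_cancel₀ _ hb1]
  · refine ⟨algebraMap R 𝔭.ResidueField (a 0) / algebraMap R 𝔭.ResidueField (b 0), ?_⟩
    ext i
    fin_cases i
    · simp [div_mul_cancel₀ _ hb0]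
    · simp only [Fin.mk_one, Pi.smul_apply, smul_eq_mul]
      field_simp
      linear_combination key'

/-- `P ≡ P' mod 𝔭`: the two points of `ℙ¹(F)` have the same reduction modulo `𝔭`. -/
def CongrMod (P P' : P1 F) : Prop :=
  ∃ Q : P1 𝔭.ResidueField, IsReduction 𝔭 P Q ∧ IsReduction 𝔭 P' Q

end Reduction

-- Suppose that only finitely many primes occur. The coordinate `1 / (x - β)` sends `β` to infinity;
-- let `a n` be the coordinate of `φ^(kn)(α)`, where `φ^k` fixes `β`. A prime at which `a n` has a
-- pole is a prime where `φ^(kn)(α)` meets `β`. Hence, once `s` is divisible by the finitely many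
-- exceptions and by some denominators, all `a n` lie in the ring `O` of elements integral over
-- `A[1/s]` (`exists_prime_of_notMem_awayIntegers`, `congrMod_of_pole`).
--
-- In this coordinate `φ^k` is a quotient `f / g` of coprime polynomials. With `D = deg f`, one has
-- `deg g < D` because infinity is fixed, and `deg g ≥ 1` because `β` is not exceptional. A Bézout
-- relation `u f + w g = 1` over `O` gives `(u(a n) a (n+1) + w(a n)) g(a n) = 1`, so `g(a n)` is a
-- unit of `O`.
--
-- Now measure `a n` at the finitely many places `v` attached to `s` by `l v n = log max(1, |a
-- n|_v)`, with sum `H n`. The product formula for the unit `g(a n)` gives `H (n+1) ≥ D * H n - C`.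
-- Locally, however, `f / g` has a pole at infinity of order between `1` and `D - 1`, so a large `l
-- v n` grows at most by the factor `D - 1` and loses at most a constant. A place that stays near
-- infinity therefore has a geometrically decaying share of `H`, while by pigeonhole some place
-- keeps returning to a share of at least `1 / N`, for `N` places. So `H` is bounded
-- (`no_growth_of_bounded_local_growth`), against the Northcott property and the infinitude of the
-- orbit. No Diophantine approximation enters.
--
-- The places, their product formula and the Northcott property come from the principal ideal domain
-- `A` and are carried to `F` through embeddings of a separable subextension and a power of
-- Frobenius (`IsGlobalBase.exists_family`).

universe u

/-! ### Global growth against local growth -/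

theorem no_growth_of_bounded_local_growth {ι : Type*} [Fintype ι] (l : ι → ℕ → ℝ)
    (hl : ∀ i n, 0 ≤ l i n) (D C ρ : ℝ) (hD : 2 ≤ D)
    (hglob : ∀ n, D * (∑ i, l i n) - C ≤ ∑ i, l i (n + 1))
    (hup : ∀ i n, ρ ≤ l i n → l i (n + 1) ≤ (D - 1) * l i n + C)
    (hlow : ∀ i n, ρ ≤ l i n → l i n - C ≤ l i (n + 1))
    (hunb : ∀ B, ∃ n, B ≤ ∑ i, l i n) : False := by
  classical
  wlog hC : 0 ≤ C generalizing C
  · push Not at hC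
    refine this 0 (fun n => ?_) (fun i n h => ?_) (fun i n h => ?_) le_rfl
    · linarith [hglob n]
    · linarith [hup i n h]
    · linarith [hlow i n h]
  wlog hρ : 3 * C ≤ ρ generalizing ρ
  · exact this (3 * C) (fun i n h => hup i n (by linarith)) (fun i n h => hlow i n (by linarith))
      le_rfl
  set H : ℕ → ℝ := fun n => ∑ i, l i n with hH
  set N : ℝ := (Fintype.card ι : ℝ) with hN
  have hN1 : 1 ≤ N := by
    rcases isEmpty_or_nonempty ι with h | h
    · obtain ⟨n, hn⟩ := hunb 1
      simp at hn
      linarith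
    · rw [hN]; exact_mod_cast Fintype.card_pos (α := ι)
  -- When `C` is at most a third of both `l i n` and `H n`, the local growth factor is at most `D -
  -- 2/3` and the global one at least `D - 1/3`; `θ` bounds the change of the share `l i n / H n`.
  set θ : ℝ := (D - 2 / 3) / (D - 1 / 3) with hθ
  have hθ0 : 0 ≤ θ := div_nonneg (by linarith) (by linarith)
  have hθ1 : θ < 1 := by rw [hθ, div_lt_one] <;> linarith
  have hθD : θ * (D - 1 / 3) = D - 2 / 3 := div_mul_cancel₀ _ (by linarith)
  obtain ⟨j, hj⟩ := exists_pow_lt_of_lt_one (show 0 < 1 / N by positivity) hθ1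
  -- Among `L + 1` consecutive times, one index must carry a share of at least `1 / N` more than `j`
  -- times.
  set L : ℕ := Fintype.card ι * j with hL
  -- A term carrying `1 / N` of this total can lose `C` at each of `L` steps and still be at least
  -- `ρ`.
  obtain ⟨n₀, hn₀⟩ := hunb (3 * C + 1 + N * (L * C + ρ))
  have hpos : 0 ≤ N * (L * C + ρ) := by
    have : 0 ≤ ρ := by linarith
    positivity
  have hbig : ∀ t, 3 * C + 1 + N * (L * C + ρ) ≤ H (n₀ + t) := by
    intro t
    induction t with
    | zero => exact hn₀
    | succ t ih =>
      have := hglob (n₀ + t)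
      have h2 : 2 * H (n₀ + t) ≤ D * H (n₀ + t) := by
        apply mul_le_mul_of_nonneg_right hD; linarith
      change _ ≤ H (n₀ + t + 1)
      change D * H (n₀ + t) - C ≤ H (n₀ + t + 1) at this
      linarith
  have hex : ∀ n, ∃ i, H n / N ≤ l i n := by
    intro n
    by_contra! h
    have hne : (Finset.univ : Finset ι).Nonempty := by
      rw [Finset.univ_nonempty_iff]
      by_contra hc
      rw [not_nonempty_iff] at hc
      have : N = 0 := by simp [hN]
      linarith
    have := Finset.sum_lt_sum_of_nonempty hne (fun i _ => h i)
    rw [Finset.sum_const, Finset.card_univ, nsmul_eq_mul, ← hN, mul_div_cancel₀ _ (by linarith)]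
      at this
    exact lt_irrefl _ this
  choose c hc using hex
  obtain ⟨i, -, hi⟩ := Finset.exists_lt_card_fiber_of_mul_lt_card_of_maps_to
    (s := Finset.range (L + 1)) (t := Finset.univ) (f := fun t => c (n₀ + t)) (n := j)
    (fun _ _ => Finset.mem_univ _) (by simp [hL])
  set S := (Finset.range (L + 1)).filter (fun t => c (n₀ + t) = i) with hS
  have hSne : S.Nonempty := Finset.card_pos.1 (by omega)
  have hmin := Finset.mem_filter.1 (S.min'_mem hSne)
  have hmax := Finset.mem_filter.1 (S.max'_mem hSne)
  have hcard : S.card ≤ S.max' hSne + 1 - S.min' hSne := by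
    rw [← Nat.card_Icc]
    exact Finset.card_le_card fun x hx =>
      Finset.mem_Icc.2 ⟨S.min'_le x hx, S.le_max' x hx⟩
  obtain ⟨t, ht⟩ : ∃ t, S.max' hSne = S.min' hSne + t :=
    Nat.exists_eq_add_of_le (S.min'_le _ (S.max'_mem hSne))
  have hjt : j ≤ t := by omega
  have htL : t ≤ L := by have := Finset.mem_range.1 hmax.1; omega
  set n₁ := n₀ + S.min' hSne with hn₁
  have h1 : H n₁ / N ≤ l i n₁ := by
    have := hc n₁
    rwa [hn₁, hmin.2] at this
  have h2 : H (n₁ + t) / N ≤ l i (n₁ + t) := by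
    have := hc (n₁ + t)
    rwa [hn₁, add_assoc, ← ht, hmax.2, ht, ← add_assoc] at this
  have hbig1 : ∀ s, 3 * C + 1 + N * (L * C + ρ) ≤ H (n₁ + s) := fun s => by
    rw [hn₁, add_assoc n₀]; exact hbig _
  have h3 : L * C + ρ ≤ l i n₁ := by
    refine le_trans ?_ h1
    rw [le_div_iff₀ (by linarith)]
    have := hbig1 0
    simp only [add_zero] at this
    linarith
  -- From its first dominant time on, the term never drops below `ρ` within the window, so both
  -- local bounds apply at every step. At its last dominant time, at least `j` steps later, its
  -- share is at most `θ ^ j < 1 / N`.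
  have h4 : ∀ s ≤ L, l i n₁ - s * C ≤ l i (n₁ + s) ∧ l i (n₁ + s) ≤ θ ^ s * H (n₁ + s) := by
    intro s
    induction s with
    | zero =>
      intro _
      refine ⟨by simp, ?_⟩
      simpa using Finset.single_le_sum (f := fun i => l i n₁) (fun i _ => hl i n₁)
        (Finset.mem_univ i)
    | succ s ih =>
      intro hs
      obtain ⟨ih1, ih2⟩ := ih (by omega)
      have hsL : (s : ℝ) * C ≤ L * C :=
        mul_le_mul_of_nonneg_right (by exact_mod_cast (by omega : s ≤ L)) hC
      have hρs : ρ ≤ l i (n₁ + s) := by linarith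
      have a1 := hup i _ hρs
      have a2 := hlow i _ hρs
      have a3 := hglob (n₁ + s)
      have a4 := hbig1 s
      change D * H (n₁ + s) - C ≤ H (n₁ + s + 1) at a3
      rw [← add_assoc]
      refine ⟨by push_cast; linarith, ?_⟩
      calc l i (n₁ + s + 1) ≤ (D - 2 / 3) * l i (n₁ + s) := by linarith
        _ ≤ (D - 2 / 3) * (θ ^ s * H (n₁ + s)) :=
            mul_le_mul_of_nonneg_left ih2 (by linarith)
        _ = θ ^ (s + 1) * ((D - 1 / 3) * H (n₁ + s)) := by rw [← hθD]; ring
        _ ≤ θ ^ (s + 1) * H (n₁ + s + 1) :=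
            mul_le_mul_of_nonneg_left (by linarith) (by positivity)
  have h5 := (h4 t htL).2
  have h6 : 0 < H (n₁ + t) := by linarith [hbig1 t]
  have h7 : θ ^ t ≤ θ ^ j := pow_le_pow_of_le_one hθ0 hθ1.le hjt
  have h8 : θ ^ t * H (n₁ + t) < 1 / N * H (n₁ + t) :=
    mul_lt_mul_of_pos_right (lt_of_le_of_lt h7 hj) h6
  rw [one_div_mul_eq_div] at h8
  linarith

/-! ### Local estimates near infinity -/

namespace AbsoluteValue

open Polynomial

variable {F : Type*} [Field F] (v : AbsoluteValue F ℝ)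

theorem sum_le_sum' {ι : Type*} (s : Finset ι) (f : ι → F) : v (∑ i ∈ s, f i) ≤ ∑ i ∈ s, v (f i) :=
  Finset.le_sum_of_subadditive v (map_zero v).le (fun x y => v.add_le x y) s f

theorem eval_le_of_le (p : F[X]) (R : ℝ) :
    ∃ M : ℝ, 0 ≤ M ∧ ∀ x, v x ≤ R → v (p.eval x) ≤ M := by
  refine ⟨∑ i ∈ Finset.range (p.natDegree + 1), v (p.coeff i) * |R| ^ i,
    Finset.sum_nonneg fun i _ => mul_nonneg (v.nonneg _) (by positivity), fun x hx => ?_⟩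
  rw [eval_eq_sum_range]
  refine (v.sum_le_sum' _ _).trans (Finset.sum_le_sum fun i _ => ?_)
  rw [map_mul, map_pow]
  exact mul_le_mul_of_nonneg_left
    (pow_le_pow_left₀ (v.nonneg _) (hx.trans (le_abs_self R)) _) (v.nonneg _)

/-- Beyond `R = 1 + 2S/c` the lower terms together amount to at most half of the leading term. -/
theorem log_eval_near_infinity (p : F[X]) (hp : p ≠ 0) :
    ∃ R C : ℝ, 1 ≤ R ∧ ∀ x, R ≤ v x → p.eval x ≠ 0 ∧
      |Real.log (v (p.eval x)) - p.natDegree * Real.log (v x)| ≤ C := by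
  set n := p.natDegree
  set c := v p.leadingCoeff with hc
  have hc0 : 0 < c := v.pos (leadingCoeff_ne_zero.2 hp)
  set S := ∑ i ∈ Finset.range n, v (p.coeff i) with hS
  have hS0 : 0 ≤ S := Finset.sum_nonneg fun i _ => v.nonneg _
  refine ⟨1 + 2 * S / c, |Real.log (c / 2)| + |Real.log (2 * c)|, by
    have : 0 ≤ 2 * S / c := by positivity
    linarith, fun x hx => ?_⟩
  have hx1 : 1 ≤ v x := by
    have : 0 ≤ 2 * S / c := by positivity
    linarith
  have hxS : 2 * S ≤ c * v x := by
    have : 2 * S / c ≤ v x := by linarith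
    rw [div_le_iff₀ hc0] at this
    linarith
  have hx0 : 0 < v x := by linarith
  set r := ∑ i ∈ Finset.range n, p.coeff i * x ^ i with hr
  have hev : p.eval x = r + p.leadingCoeff * x ^ n := by
    rw [eval_eq_sum_range, Finset.sum_range_succ]
    rfl
  have hrS : v x * v r ≤ S * v x ^ n := by
    calc v x * v r ≤ v x * ∑ i ∈ Finset.range n, v (p.coeff i * x ^ i) :=
          mul_le_mul_of_nonneg_left (v.sum_le_sum' _ _) hx0.le
      _ = ∑ i ∈ Finset.range n, v (p.coeff i) * v x ^ (i + 1) := by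
          rw [Finset.mul_sum]
          refine Finset.sum_congr rfl fun i _ => ?_
          rw [map_mul, map_pow]; ring
      _ ≤ ∑ i ∈ Finset.range n, v (p.coeff i) * v x ^ n :=
          Finset.sum_le_sum fun i hi => mul_le_mul_of_nonneg_left
            (pow_le_pow_right₀ hx1 (Finset.mem_range.1 hi)) (v.nonneg _)
      _ = S * v x ^ n := by rw [Finset.sum_mul]
  have hxn : 0 < v x ^ n := by positivity
  have hrc : v r ≤ c / 2 * v x ^ n := by
    have : v x * v r ≤ v x * (c / 2 * v x ^ n) := by
      refine hrS.trans ?_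
      have := mul_le_mul_of_nonneg_right hxS hxn.le
      linarith
    exact le_of_mul_le_mul_left this hx0
  have hlead : v (p.leadingCoeff * x ^ n) = c * v x ^ n := by rw [map_mul, map_pow]
  have hub : v (p.eval x) ≤ 2 * c * v x ^ n := by
    rw [hev]
    have := v.add_le r (p.leadingCoeff * x ^ n)
    rw [hlead] at this
    have : 0 < c * v x ^ n := by positivity
    linarith
  have hlb : c / 2 * v x ^ n ≤ v (p.eval x) := by
    have := v.add_le (p.eval x) (-r)
    rw [show p.eval x + -r = p.leadingCoeff * x ^ n by rw [hev]; ring, hlead, v.map_neg] at this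
    linarith
  have hpos : 0 < v (p.eval x) := lt_of_lt_of_le (by positivity) hlb
  refine ⟨fun h => by simp [h] at hpos, ?_⟩
  have h1 := Real.log_le_log (by positivity) hlb
  have h2 := Real.log_le_log hpos hub
  rw [Real.log_mul (by positivity) (by positivity), Real.log_pow] at h1 h2
  have h3 := neg_abs_le (Real.log (c / 2))
  have h4 := le_abs_self (Real.log (2 * c))
  have h5 := abs_nonneg (Real.log (c / 2))
  have h6 := abs_nonneg (Real.log (2 * c))
  rw [abs_le]
  constructor <;> linarith

/-- The logarithmic proximity to infinity. -/
noncomputable def proximity (x : F) : ℝ := Real.log (max 1 (v x))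

theorem proximity_nonneg (x : F) : 0 ≤ v.proximity x := Real.log_nonneg (le_max_left _ _)

theorem le_exp_proximity (x : F) : v x ≤ Real.exp (v.proximity x) := by
  rw [proximity, Real.exp_log (by positivity)]
  exact le_max_right _ _

theorem proximity_of_one_le {x : F} (hx : 1 ≤ v x) : v.proximity x = Real.log (v x) := by
  rw [proximity, max_eq_right hx]

/-- For large `x` the leading term of `f` decides; for bounded `x` the Bézout relation prevents `f`
and `g` from being small together. -/
theorem proximity_lower_bound {f g u w : F[X]} (hfg : u * f + w * g = 1) (hf : f ≠ 0) :
    ∃ C : ℝ, ∀ x, f.natDegree * v.proximity x - C ≤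
      Real.log (max (v (f.eval x)) (v (g.eval x))) := by
  obtain ⟨R, C₁, hR, h₁⟩ := v.log_eval_near_infinity f hf
  obtain ⟨M, hM, hu⟩ := v.eval_le_of_le u R
  obtain ⟨M', hM', hw⟩ := v.eval_le_of_le w R
  refine ⟨max C₁ (f.natDegree * Real.log R + Real.log (M + M' + 1)), fun x => ?_⟩
  rcases le_or_gt R (v x) with hx | hx
  · obtain ⟨h0, h2⟩ := h₁ x hx
    rw [v.proximity_of_one_le (hR.trans hx)]
    have h3 := Real.log_le_log (v.pos h0) (le_max_left (v (f.eval x)) (v (g.eval x)))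
    have h4 := (abs_le.1 h2).1
    have h5 := le_max_left C₁ (f.natDegree * Real.log R + Real.log (M + M' + 1))
    linarith
  · have h1 : v.proximity x ≤ Real.log R :=
      Real.log_le_log (by positivity) (max_le hR hx.le)
    set m := max (v (f.eval x)) (v (g.eval x)) with hm
    have e : (1 : ℝ) ≤ (M + M' + 1) * m := by
      have h2 := congrArg (fun p => v (p.eval x)) hfg
      simp only [eval_add, eval_mul, eval_one, map_one] at h2
      refine h2.symm.le.trans ((v.add_le _ _).trans ?_)
      rw [map_mul, map_mul]
      have m0 : 0 ≤ m := (v.nonneg _).trans (le_max_left _ _)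
      have := mul_le_mul (hu x hx.le) (le_max_left (v (f.eval x)) (v (g.eval x))) (v.nonneg _) hM
      have := mul_le_mul (hw x hx.le) (le_max_right (v (f.eval x)) (v (g.eval x))) (v.nonneg _) hM'
      linarith
    have hmpos : 0 < m := by
      by_contra! h
      have : (M + M' + 1) * m ≤ 0 := mul_nonpos_of_nonneg_of_nonpos (by positivity) h
      linarith
    have h3 := Real.log_nonneg e
    rw [Real.log_mul (by positivity) hmpos.ne'] at h3
    have h5 := le_max_right C₁ (f.natDegree * Real.log R + Real.log (M + M' + 1))
    have h6 := mul_le_mul_of_nonneg_left h1 (Nat.cast_nonneg (α := ℝ) f.natDegree)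
    linarith

/-- The pole of `f / g` at infinity has order `deg f - deg g`. The upper bound uses that this is at
most `deg f - 1`, the lower bound that it is at least `1`. -/
theorem proximity_div_near_infinity {f g : F[X]} (hg : g ≠ 0) (h : g.natDegree < f.natDegree)
    (hg1 : 1 ≤ g.natDegree) :
    ∃ ρ C : ℝ, ∀ x y, y * g.eval x = f.eval x → ρ ≤ v.proximity x →
      v.proximity y ≤ (f.natDegree - 1) * v.proximity x + C ∧
      v.proximity x - C ≤ v.proximity y := by
  have hf : f ≠ 0 := by rintro rfl; simp at h
  obtain ⟨R₁, C₁, hR₁, h₁⟩ := v.log_eval_near_infinity f hf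
  obtain ⟨R₂, C₂, hR₂, h₂⟩ := v.log_eval_near_infinity g hg
  refine ⟨Real.log (R₁ + R₂), |C₁ + C₂|, fun x y hxy hx => ?_⟩
  have hxR : R₁ + R₂ ≤ v x := by
    have h3 := (Real.log_le_log_iff (by linarith) (by positivity)).1 hx
    rcases le_max_iff.1 h3 with h4 | h4
    · linarith
    · exact h4
  have hx1 : 1 ≤ v x := by linarith
  obtain ⟨f0, h3⟩ := h₁ x (by linarith)
  obtain ⟨g0, h4⟩ := h₂ x (by linarith)
  rw [v.proximity_of_one_le hx1]
  have hL : 0 ≤ Real.log (v x) := Real.log_nonneg hx1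
  have hy : y ≠ 0 := by rintro rfl; simp at hxy; exact f0 hxy.symm
  have hlog : Real.log (v y) = Real.log (v (f.eval x)) - Real.log (v (g.eval x)) := by
    rw [← hxy, map_mul, Real.log_mul (v.ne_zero hy) (v.ne_zero g0)]; ring
  rw [abs_le] at h3 h4
  have hge : Real.log (v y) ≤ v.proximity y :=
    Real.log_le_log (v.pos hy) (le_max_right _ _)
  have hC := le_abs_self (C₁ + C₂)
  have hd : (g.natDegree : ℝ) + 1 ≤ f.natDegree := by exact_mod_cast h
  have hg1' : (1 : ℝ) ≤ g.natDegree := by exact_mod_cast hg1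
  have hd1 := mul_le_mul_of_nonneg_right hd hL
  have hg2 := mul_le_mul_of_nonneg_right hg1' hL
  constructor
  · rcases le_total 1 (v y) with h5 | h5
    · rw [v.proximity_of_one_le h5, hlog]; linarith
    · rw [proximity, max_eq_left h5, Real.log_one]
      have : 0 ≤ ((f.natDegree : ℝ) - 1) * Real.log (v x) := mul_nonneg (by linarith) hL
      have := abs_nonneg (C₁ + C₂)
      linarith
  · rw [hlog] at hge; linarith

theorem eval_mem_of_coeff_mem (O : Subring F) {p : F[X]} (hp : ∀ n, p.coeff n ∈ O) {x : F}
    (hx : x ∈ O) : p.eval x ∈ O := by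
  rw [eval_eq_sum_range]
  exact O.sum_mem fun i _ => O.mul_mem (hp i) (O.pow_mem hx i)

/-- An infinite orbit of a rational map `f / g` which fixes `∞`, but is not a polynomial, is not
contained in a ring with the product formula for units and the Northcott property. -/
theorem not_injective_of_mem_subring (O : Subring F) {ι : Type*} [Fintype ι]
    (v : ι → AbsoluteValue F ℝ) (hP : ∀ x ∈ O, x⁻¹ ∈ O → x ≠ 0 → ∏ i, v i x = 1)
    (hN : ∀ B : ℝ, {x | x ∈ O ∧ ∀ i, v i x ≤ B}.Finite) {f g u w : F[X]}
    (hfg : u * f + w * g = 1) (hg : ∀ n, g.coeff n ∈ O)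
    (hu : ∀ n, u.coeff n ∈ O) (hw : ∀ n, w.coeff n ∈ O) (hg1 : 1 ≤ g.natDegree)
    (hdeg : g.natDegree < f.natDegree) (a : ℕ → F) (ha : ∀ n, a n ∈ O)
    (hrec : ∀ n, a (n + 1) * g.eval (a n) = f.eval (a n)) : ¬ Function.Injective a := by
  intro hinj
  have hf0 : f ≠ 0 := by rintro rfl; simp at hdeg
  have hg0 : g ≠ 0 := by rintro rfl; simp at hg1
  have hbez : ∀ n, (u.eval (a n) * a (n + 1) + w.eval (a n)) * g.eval (a n) = 1 := by
    intro n
    have := congrArg (eval (a n)) hfg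
    simp only [eval_add, eval_mul, eval_one] at this
    rw [← hrec] at this
    linear_combination this
  have hga : ∀ n, g.eval (a n) ≠ 0 := fun n => right_ne_zero_of_mul_eq_one (hbez n)
  have hprod : ∀ n, ∑ i, Real.log (v i (g.eval (a n))) = 0 := by
    intro n
    rw [← Real.log_prod fun i _ => (v i).ne_zero (hga n), hP _ (eval_mem_of_coeff_mem O hg (ha n))
      _ (hga n), Real.log_one]
    rw [← eq_inv_of_mul_eq_one_left (hbez n)]
    exact O.add_mem (O.mul_mem (eval_mem_of_coeff_mem O hu (ha n)) (ha _))
      (eval_mem_of_coeff_mem O hw (ha n))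
  choose C₁ h₁ using fun i => (v i).proximity_lower_bound hfg hf0
  choose ρ C₂ h₂ using fun i => (v i).proximity_div_near_infinity hg0 hdeg hg1
  have hC₁ : ∀ s : Finset ι, 0 ≤ ∑ i ∈ s, |C₁ i| := fun s => Finset.sum_nonneg fun i _ => abs_nonneg _
  have hC₂ : ∀ i, C₂ i ≤ ∑ i, |C₂ i| := fun i => (le_abs_self _).trans
    (Finset.single_le_sum (f := fun i => |C₂ i|) (fun i _ => abs_nonneg _) (Finset.mem_univ i))
  have hρ : ∀ i, ρ i ≤ ∑ i, |ρ i| := fun i => (le_abs_self _).trans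
    (Finset.single_le_sum (f := fun i => |ρ i|) (fun i _ => abs_nonneg _) (Finset.mem_univ i))
  refine no_growth_of_bounded_local_growth (fun i n => (v i).proximity (a n))
    (fun i n => (v i).proximity_nonneg _) f.natDegree (∑ i, |C₁ i| + ∑ i, |C₂ i|) (∑ i, |ρ i|)
    (by exact_mod_cast (by omega : 2 ≤ f.natDegree)) (fun n => ?_) (fun i n h => ?_)
    (fun i n h => ?_) (fun B => ?_)
  -- Dividing by `g(a n)` changes each local term by `log |g(a n)|`, and these changes cancel in the
  -- sum because `g(a n)` is a unit.
  · have h3 : ∀ i, Real.log (max (v i (f.eval (a n))) (v i (g.eval (a n)))) =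
        (v i).proximity (a (n + 1)) + Real.log (v i (g.eval (a n))) := by
      intro i
      have hpos := (v i).pos (hga n)
      rw [proximity, ← Real.log_mul (by positivity) hpos.ne', max_mul_of_nonneg _ _ hpos.le,
        one_mul, ← map_mul, hrec, max_comm]
    have h4 := Finset.sum_le_sum fun i (_ : i ∈ Finset.univ) => h₁ i (a n)
    simp only [h3, Finset.sum_add_distrib, hprod, Finset.sum_sub_distrib, ← Finset.mul_sum] at h4
    have h5 : ∑ i, C₁ i ≤ ∑ i, |C₁ i| := Finset.sum_le_sum fun i _ => le_abs_self _
    have h6 : 0 ≤ ∑ i, |C₂ i| := Finset.sum_nonneg fun i _ => abs_nonneg _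
    linarith
  · have := (h₂ i _ _ (hrec n) ((hρ i).trans h)).1
    linarith [hC₂ i, hC₁ Finset.univ]
  · have := (h₂ i _ _ (hrec n) ((hρ i).trans h)).2
    linarith [hC₂ i, hC₁ Finset.univ]
  · by_contra! h
    refine Set.infinite_range_of_injective hinj ((hN (Real.exp B)).subset ?_)
    rintro _ ⟨n, rfl⟩
    refine ⟨ha n, fun i => ((v i).le_exp_proximity _).trans (Real.exp_le_exp.2 ?_)⟩
    exact (Finset.single_le_sum (f := fun i => (v i).proximity (a n))
      (fun i _ => (v i).proximity_nonneg _) (Finset.mem_univ i)).trans (h n).le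

end AbsoluteValue

/-! ### Product formula and Northcott property over the base ring -/

namespace AbsoluteValue

open Polynomial WithZero IsDedekindDomain

/-- `v` is nonarchimedean and nontrivial, or induced by an embedding in `ℂ`. -/
def IsUltrametricOrComplex {K : Type*} [Field K] (v : AbsoluteValue K ℝ) : Prop :=
  (IsNonarchimedean v ∧ ∃ x, x ≠ 0 ∧ v x < 1) ∨ ∃ σ : K →+* ℂ, ∀ x, ‖σ x‖ = v x

/-- `v` behaves on `A` like the archimedean absolute value on `ℤ`. -/
structure IsSize (A : Type*) {K : Type*} [CommRing A] [Field K] [Algebra A K]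
    (v : AbsoluteValue K ℝ) : Prop where
  one_le : ∀ a : A, a ≠ 0 → 1 ≤ v (algebraMap A K a)
  isUnit : ∀ a : A, v (algebraMap A K a) = 1 → IsUnit a
  finite : ∀ B : ℝ, {a : A | v (algebraMap A K a) ≤ B}.Finite
  ext : v.IsUltrametricOrComplex

/-- The absolute value of base `b` attached to a valuation. -/
noncomputable def ofValuation {K : Type*} [Field K] (v : Valuation K ℤᵐ⁰) {b : NNReal}
    (hb : 1 < b) : AbsoluteValue K ℝ where
  toFun x := WithZeroMulInt.toNNReal (ne_zero_of_lt hb) (v x)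
  map_mul' _ _ := by simp
  nonneg' _ := NNReal.zero_le_coe
  eq_zero' _ := by simp
  add_le' x y := by
    have h := (WithZeroMulInt.toNNReal_strictMono hb).monotone (v.map_add x y)
    rw [(WithZeroMulInt.toNNReal_strictMono hb).monotone.map_max] at h
    exact_mod_cast h.trans (max_le_add_of_nonneg (zero_le) (zero_le))

theorem isNonarchimedean_ofValuation {K : Type*} [Field K] (v : Valuation K ℤᵐ⁰) {b : NNReal}
    (hb : 1 < b) : IsNonarchimedean (ofValuation v hb) := by
  intro x y
  have h := (WithZeroMulInt.toNNReal_strictMono hb).monotone (v.map_add x y)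
  rw [(WithZeroMulInt.toNNReal_strictMono hb).monotone.map_max] at h
  exact_mod_cast h

theorem toNNReal_exp {b : NNReal} (hb : b ≠ 0) (n : ℤ) :
    WithZeroMulInt.toNNReal hb (exp n) = b ^ n := by
  rw [WithZeroMulInt.toNNReal_neg_apply hb exp_ne_zero]
  rfl

theorem exists_isSize_int : ∃ v : AbsoluteValue ℚ ℝ, IsSize ℤ v := by
  have key : ∀ a : ℤ, NormedField.toAbsoluteValue ℚ (algebraMap ℤ ℚ a) = |(a : ℝ)| := fun a => by
    change ‖algebraMap ℤ ℚ a‖ = _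
    rw [eq_intCast, Int.norm_cast_rat, Int.norm_eq_abs]
  refine ⟨NormedField.toAbsoluteValue ℚ, fun a ha => ?_, fun a ha => ?_, fun B => ?_, Or.inr
    ⟨algebraMap ℚ ℂ, fun x => norm_algebraMap' ℂ x⟩⟩
  · rw [key]
    exact_mod_cast Int.one_le_abs ha
  · rw [key] at ha
    exact Int.isUnit_iff_abs_eq.2 (by exact_mod_cast ha)
  · refine (Set.finite_Icc (-⌈B⌉) ⌈B⌉).subset fun a ha => ?_
    have ha : NormedField.toAbsoluteValue ℚ (algebraMap ℤ ℚ a) ≤ B := ha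
    rw [key] at ha
    have : |a| ≤ ⌈B⌉ := by exact_mod_cast ha.trans (Int.le_ceil B)
    exact abs_le.1 this

theorem finite_natDegree_le {k : Type*} [Field k] [Finite k] (n : ℕ) :
    {p : k[X] | p.natDegree ≤ n}.Finite := by
  refine Set.Finite.of_injOn (f := fun p (i : Fin (n + 1)) => p.coeff i) (t := Set.univ)
    (fun _ _ => Set.mem_univ _) (fun p hp q hq h => ?_) Set.finite_univ
  ext i
  by_cases hi : i < n + 1
  · exact congrFun h ⟨i, hi⟩
  · rw [coeff_eq_zero_of_natDegree_lt (by have : p.natDegree ≤ n := hp; omega),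
      coeff_eq_zero_of_natDegree_lt (by have : q.natDegree ≤ n := hq; omega)]

/-- The place at infinity, normalized so that a nonzero polynomial `p` has size `2 ^ deg p`; `1 / X`
witnesses nontriviality. -/
theorem exists_isSize_polynomial (k : Type*) [Field k] [Finite k] :
    ∃ v : AbsoluteValue (RatFunc k) ℝ, IsSize k[X] v := by
  classical
  set v := ofValuation (RatFunc.inftyValuation k) (b := 2) (by norm_num) with hv
  have key : ∀ p : k[X], p ≠ 0 → v (algebraMap k[X] (RatFunc k) p) = 2 ^ p.natDegree := by
    intro p hp
    change ((WithZeroMulInt.toNNReal _ (RatFunc.inftyValuationDef k _) : NNReal) : ℝ) = _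
    rw [RatFunc.inftyValuation.polynomial k hp, toNNReal_exp]
    simp
  refine ⟨v, fun a ha => ?_, fun a ha => ?_, fun B => ?_, Or.inl
    ⟨isNonarchimedean_ofValuation _ _, (algebraMap k[X] (RatFunc k) X)⁻¹, ?_, ?_⟩⟩
  · rw [key a ha]
    exact one_le_pow₀ (by norm_num)
  · rcases eq_or_ne a 0 with rfl | h0
    · simp at ha
    rw [key a h0, pow_eq_one_iff_cases] at ha
    exact isUnit_iff_degree_eq_zero.2 (by
      rw [degree_eq_natDegree h0]
      rcases ha with h | h | h
      · rw [h]; rfl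
      · norm_num at h
      · norm_num at h)
  · obtain ⟨n, hn⟩ := pow_unbounded_of_one_lt B (show (1 : ℝ) < 2 by norm_num)
    refine (finite_natDegree_le (k := k) n).subset fun a ha => ?_
    rcases eq_or_ne a 0 with rfl | h0
    · simp
    have ha : v (algebraMap k[X] (RatFunc k) a) ≤ B := ha
    rw [key a h0] at ha
    exact ((pow_lt_pow_iff_right₀ (by norm_num)).1 (ha.trans_lt hn)).le
  · simpa using RatFunc.X_ne_zero
  · rw [map_inv₀, key X X_ne_zero]
    norm_num

theorem IsSize.of_ringEquiv {A B K L : Type*} [CommRing A] [IsDomain A] [CommRing B] [IsDomain B]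
    [Field K] [Field L]
    [Algebra A K] [IsFractionRing A K] [Algebra B L] [IsFractionRing B L] (e : A ≃+* B)
    {v : AbsoluteValue L ℝ} (hv : IsSize B v) :
    ∃ w : AbsoluteValue K ℝ, IsSize A w := by
  set f : K ≃+* L := IsFractionRing.ringEquivOfRingEquiv e with hf
  have hfa : ∀ a, f (algebraMap A K a) = algebraMap B L (e a) :=
    IsFractionRing.ringEquivOfRingEquiv_algebraMap e
  refine ⟨v.comp f.injective, fun a ha => ?_, fun a ha => ?_, fun C => ?_, ?_⟩
  · change 1 ≤ v (f _)
    rw [hfa]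
    exact hv.one_le _ (by simpa using ha)
  · change v (f _) = 1 at ha
    rw [hfa] at ha
    simpa using hv.isUnit _ ha
  · refine ((hv.finite C).preimage e.injective.injOn).subset fun a ha => ?_
    change v (f _) ≤ C at ha
    rwa [hfa] at ha
  · rcases hv.ext with ⟨h, x, hx0, hx⟩ | ⟨σ, hσ⟩
    · refine Or.inl ⟨fun x y => ?_, f.symm x, by simpa using hx0, ?_⟩
      · change v (f (x + y)) ≤ _
        rw [map_add]
        exact h _ _
      · change v (f _) < 1
        simpa using hx
    · exact Or.inr ⟨σ.comp (f : K →+* L), fun x => hσ _⟩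

theorem _root_.IsGlobalBase.exists_isSize {A K : Type*} [CommRing A] [Field K] [Algebra A K]
    [IsFractionRing A K] (hA : IsGlobalBase A) : ∃ v : AbsoluteValue K ℝ, IsSize A v := by
  have : IsDomain A := (IsFractionRing.injective A K).isDomain (algebraMap A K)
  rcases hA with ⟨⟨e⟩⟩ | ⟨p, hp, ⟨e⟩⟩
  · obtain ⟨v, hv⟩ := exists_isSize_int
    exact hv.of_ringEquiv e
  · have : Fact p.Prime := ⟨hp⟩
    obtain ⟨v, hv⟩ := exists_isSize_polynomial (ZMod p)
    exact hv.of_ringEquiv e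

theorem _root_.IsGlobalBase.isPrincipalIdealRing {A : Type*} [CommRing A]
    (hA : IsGlobalBase A) : IsPrincipalIdealRing A := by
  rcases hA with ⟨⟨e⟩⟩ | ⟨p, hp, ⟨e⟩⟩
  · exact IsPrincipalIdealRing.of_surjective e.symm e.symm.surjective
  · have : Fact p.Prime := ⟨hp⟩
    exact IsPrincipalIdealRing.of_surjective e.symm e.symm.surjective

theorem IsSize.map_unit {A K : Type*} [CommRing A] [Field K] [Algebra A K] 
    {v : AbsoluteValue K ℝ} (hv : IsSize A v) {a : A} (ha : IsUnit a) :
    v (algebraMap A K a) = 1 := by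
  have : Nontrivial A := (algebraMap A K).domain_nontrivial
  obtain ⟨b, hb⟩ := ha.exists_right_inv
  have h1 := hv.one_le a (left_ne_zero_of_mul_eq_one hb)
  have h2 := hv.one_le b (right_ne_zero_of_mul_eq_one hb)
  have h3 : v (algebraMap A K a) * v (algebraMap A K b) = 1 := by
    rw [← map_mul, ← map_mul, hb, map_one, map_one]
  nlinarith

/-- The product formula for units and the finiteness of sets of bounded elements in `A[1/s]`. -/
theorem IsSize.exists_family {A : Type u} {K : Type*} [CommRing A] [IsDomain A]
    [IsPrincipalIdealRing A] [Field K] [Algebra A K] [IsFractionRing A K]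
    {v₀ : AbsoluteValue K ℝ} (h₀ : IsSize A v₀) (s : A) (hs : s ≠ 0) :
    ∃ (ι : Type u) (_ : Fintype ι) (v : ι → AbsoluteValue K ℝ),
      (∀ i, (v i).IsUltrametricOrComplex) ∧
      (∀ x : K, ∀ n : ℕ, x ≠ 0 → (∃ a, algebraMap A K s ^ n * x = algebraMap A K a) →
        (∃ a, algebraMap A K s ^ n * x⁻¹ = algebraMap A K a) → ∏ i, v i x = 1) ∧
      ∀ B : ℝ, {x : K | (∃ n : ℕ, ∃ a, algebraMap A K s ^ n * x = algebraMap A K a) ∧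
        ∀ i, v i x ≤ B}.Finite := by
  classical
  have inj := IsFractionRing.injective A K
  have hs' : algebraMap A K s ≠ 0 := by simpa using hs
  have hfin : {p : HeightOneSpectrum A | p.asIdeal ∣ Ideal.span {s}}.Finite :=
    Ideal.finite_factors (by simpa using hs)
  set S := hfin.toFinset with hS
  have hmemS : ∀ p : HeightOneSpectrum A, p ∈ S ↔ s ∈ p.asIdeal := by
    intro p
    simp [hS, Ideal.dvd_span_singleton]
  have hgen : ∀ p : HeightOneSpectrum A, ∃ g : A, p.asIdeal = Ideal.span {g} := fun p =>
    ⟨_, (Ideal.span_singleton_generator p.asIdeal).symm⟩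
  choose g hg using hgen
  have hg0 : ∀ p, g p ≠ 0 := fun p h => p.ne_bot (by rw [hg p, h]; simp)
  have hg1 : ∀ p, 1 < v₀ (algebraMap A K (g p)) := fun p =>
    lt_of_le_of_ne (h₀.one_le _ (hg0 p)) fun h => p.isPrime.ne_top (by
      rw [hg p, Ideal.span_singleton_eq_top]; exact h₀.isUnit _ h.symm)
  -- This base makes the size of the generator `g p` cancel its `p`-adic absolute value, which is
  -- the product formula for primes.
  set b : HeightOneSpectrum A → NNReal := fun p => ⟨v₀ (algebraMap A K (g p)), v₀.nonneg _⟩ with hb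
  have hb1 : ∀ p, 1 < b p := hg1
  set w : HeightOneSpectrum A → AbsoluteValue K ℝ := fun p => p.adicAbv (hb1 p) with hw
  have hwle : ∀ p a, w p (algebraMap A K a) ≤ 1 := fun p a => p.adicAbv_coe_le_one (K := K) (hb1 p) a
  have hwlt : ∀ p a, w p (algebraMap A K a) < 1 ↔ a ∈ p.asIdeal := fun p a =>
    p.adicAbv_coe_lt_one_iff (K := K) (hb1 p) a
  have hweq : ∀ p a, w p (algebraMap A K a) = 1 ↔ a ∉ p.asIdeal := fun p a =>
    p.adicAbv_coe_eq_one_iff (K := K) (hb1 p) a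
  have hwg : ∀ p, w p (algebraMap A K (g p)) = (v₀ (algebraMap A K (g p)))⁻¹ := by
    intro p
    change ((WithZeroMulInt.toNNReal (ne_zero_of_lt (hb1 p)) (p.valuation K _) : NNReal) : ℝ) = _
    rw [HeightOneSpectrum.valuation_of_algebraMap, HeightOneSpectrum.intValuation_singleton _ (hg0 p) (hg p),
      toNNReal_exp, zpow_neg_one]
    rfl
  set v : Option S → AbsoluteValue K ℝ := fun i => i.elim v₀ fun p => w p.1 with hv
  have hprod : ∀ x, ∏ i, v i x = v₀ x * ∏ p ∈ S, w p x := by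
    intro x
    rw [Fintype.prod_option]
    exact congrArg _ (Finset.prod_coe_sort S fun p => w p x)
  -- Induction on prime factors: a prime `q` dividing `s` is seen only by `v₀` and by its own adic
  -- absolute value.
  have hP : ∀ a : A, ∀ n : ℕ, a ∣ s ^ n → ∏ i, v i (algebraMap A K a) = 1 := by
    intro a n
    induction a using UniqueFactorizationMonoid.induction_on_prime with
    | h₁ => intro h; exact absurd (zero_dvd_iff.1 h) (pow_ne_zero _ hs)
    | h₂ a ha =>
      intro _
      rw [hprod, h₀.map_unit ha, one_mul]
      exact Finset.prod_eq_one fun p _ => (hweq p a).2 fun h =>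
        p.isPrime.ne_top (Ideal.eq_top_of_isUnit_mem _ h ha)
    | h₃ a q ha0 hq ih =>
      intro h
      rw [map_mul]
      simp only [map_mul]
      rw [Finset.prod_mul_distrib, ih ((dvd_mul_left a q).trans h), mul_one, hprod]
      have hqs : q ∣ s := hq.dvd_of_dvd_pow ((dvd_mul_right q a).trans h)
      have hqp : (Ideal.span {q}).IsPrime := (Ideal.span_singleton_prime hq.ne_zero).2 hq
      set P : HeightOneSpectrum A := ⟨Ideal.span {q}, hqp, by simpa using hq.ne_zero⟩ with hPdef
      have hPS : P ∈ S := (hmemS P).2 (Ideal.mem_span_singleton.2 hqs)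
      have hmem : ∀ p : HeightOneSpectrum A, q ∈ p.asIdeal → p = P := fun p hp => by
        have hmax : (Ideal.span {q}).IsMaximal := hqp.isMaximal P.ne_bot
        refine HeightOneSpectrum.ext (hmax.eq_of_le p.isPrime.ne_top ?_).symm
        rwa [Ideal.span_singleton_le_iff_mem]
      rw [Finset.prod_eq_single P (fun p _ hne => (hweq p q).2 fun h => hne (hmem p h))
        (fun h => absurd hPS h)]
      obtain ⟨e, he⟩ : Associated (g P) q := by
        rw [← Ideal.span_singleton_eq_span_singleton, ← hg P]
      have heq : ∀ p, p = P → w p (algebraMap A K (e : A)) = 1 := fun p _ =>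
        (hweq p _).2 fun h => p.isPrime.ne_top (Ideal.eq_top_of_isUnit_mem _ h e.isUnit)
      rw [← he, map_mul, map_mul, map_mul, heq P rfl, h₀.map_unit e.isUnit, mul_one, mul_one,
        hwg]
      exact mul_inv_cancel₀ (by have := hg1 P; positivity)
  refine ⟨Option S, inferInstance, v, ?_, ?_, fun B => ?_⟩
  · rintro (_ | p)
    · exact h₀.ext
    · refine Or.inl ⟨p.1.isNonarchimedean_adicAbv (hb1 p.1), algebraMap A K (g p.1), ?_, ?_⟩
      · simpa using hg0 p.1
      · exact (hwlt p.1 _).2 (by rw [hg p.1]; exact Ideal.mem_span_singleton_self _)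
  · rintro x n hx ⟨a, ha⟩ ⟨c, hc⟩
    -- Thus `x` is the quotient of `a` and `s ^ n`, two divisors of powers of `s`.
    have hac : a * c = s ^ (n + n) := by
      apply inj
      rw [map_mul, ← ha, ← hc, map_pow, pow_add]
      linear_combination algebraMap A K s ^ n * algebraMap A K s ^ n * mul_inv_cancel₀ hx
    have h1 := hP a (n + n) ⟨c, hac.symm⟩
    have h2 := hP (s ^ n) n dvd_rfl
    rw [← ha] at h1
    simp only [map_mul, Finset.prod_mul_distrib] at h1
    rw [map_pow] at h2
    rwa [h2, one_mul] at h1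
  -- One power `s ^ M` clears the denominators of all `x` bounded by `B`: then `s ^ M * x` is
  -- integral at every prime, and `v₀` leaves finitely many values.
  · obtain ⟨M, hM⟩ : ∃ M : ℕ, ∀ p ∈ S, w p (algebraMap A K s) ^ M * B ≤ 1 := by
      have : ∀ p ∈ S, ∀ᶠ M : ℕ in Filter.atTop, w p (algebraMap A K s) ^ M * B ≤ 1 := by
        intro p hp
        have h1 := (tendsto_pow_atTop_nhds_zero_of_lt_one ((w p).nonneg _)
          ((hwlt p s).2 ((hmemS p).1 hp))).mul_const B
        rw [zero_mul] at h1
        exact h1.eventually_le_const one_pos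
      exact ((Filter.eventually_all_finset S).2 this).exists
    refine (((h₀.finite (v₀ (algebraMap A K s) ^ M * B)).image
      (fun a => (algebraMap A K s ^ M)⁻¹ * algebraMap A K a))).subset ?_
    rintro x ⟨⟨n, a, ha⟩, hx⟩
    have hint : algebraMap A K s ^ M * x ∈ (algebraMap A K).range := by
      refine HeightOneSpectrum.mem_integers_of_valuation_le_one K _ fun p => ?_
      have key : w p (algebraMap A K s ^ M * x) ≤ 1 := by
        by_cases hp : p ∈ S
        · rw [map_mul, map_pow]
          exact (mul_le_mul_of_nonneg_left (hx (some ⟨p, hp⟩)) (by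
            have := (w p).nonneg (algebraMap A K s)
            positivity)).trans (hM p hp)
        · have h1 := (hweq p s).2 (fun h => hp ((hmemS p).2 h))
          have h2 := congrArg (w p) ha
          rw [map_mul, map_pow, h1, one_pow, one_mul] at h2
          rw [map_mul, map_pow, h1, one_pow, one_mul, h2]
          exact hwle p a
      exact (WithZeroMulInt.toNNReal_le_one_iff (hb1 p)).1 (by exact_mod_cast key)
    obtain ⟨c, hc⟩ := hint
    refine ⟨c, ?_, ?_⟩
    · change v₀ (algebraMap A K c) ≤ _
      rw [hc, map_mul, map_pow]
      exact mul_le_mul_of_nonneg_left (hx none) (by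
        have := v₀.nonneg (algebraMap A K s)
        positivity)
    · dsimp only
      rw [hc]
      field_simp

end AbsoluteValue

/-! ### Extension of absolute values to separable extensions -/

namespace AbsoluteValue

open Polynomial

/-- Complete `K`, then put the spectral norm on an algebraic closure. Nontriviality of `v` makes the
completion a nontrivially normed field, as the spectral norm requires. -/
theorem exists_isAlgClosed_of_isNonarchimedean {K : Type u} [Field K] (v : AbsoluteValue K ℝ)
    (hv : IsNonarchimedean v) (hv' : ∃ x, x ≠ 0 ∧ v x < 1) :
    ∃ (C : Type u) (_ : NormedField C) (_ : IsAlgClosed C) (σ : K →+* C), ∀ x, ‖σ x‖ = v x := by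
  have hn : ∀ x : WithAbs v, ‖(x : v.Completion)‖ = v x.ofAbs := fun x =>
    UniformSpace.Completion.norm_coe x
  have hu : IsUltrametricDist v.Completion := by
    refine IsUltrametricDist.isUltrametricDist_of_forall_norm_add_le_max_norm fun x y => ?_
    induction x, y using UniformSpace.Completion.induction_on₂ with
    | hp =>
      exact isClosed_le (by fun_prop) (by fun_prop)
    | ih x y =>
      rw [← UniformSpace.Completion.coe_add, hn, hn, hn]
      exact hv _ _
  obtain ⟨x, hx0, hx1⟩ := hv'
  let : NontriviallyNormedField v.Completion := NontriviallyNormedField.ofNormNeOne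
    ⟨((WithAbs.toAbs v x : WithAbs v) : v.Completion), by
      rw [← norm_ne_zero_iff, hn]
      simpa using hx0, by
      rw [hn]
      exact hx1.ne⟩
  let : IsUltrametricDist v.Completion := hu
  refine ⟨AlgebraicClosure v.Completion, spectralNorm.normedField v.Completion _,
    inferInstanceAs (IsAlgClosed (AlgebraicClosure v.Completion)),
    ((algebraMap v.Completion (AlgebraicClosure v.Completion)).comp
      UniformSpace.Completion.coeRingHom).comp (WithAbs.equiv v).symm.toRingHom, fun x => ?_⟩
  exact (spectralNorm_extends _).trans (hn _)

/-- The absolute values on a finite separable extension `E` which extend `v`. -/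
theorem exists_extensions_of_isAlgClosed {K E C : Type*} [Field K] [Field E] [Algebra K E]
    [FiniteDimensional K E] [Algebra.IsSeparable K E] [NormedField C] [IsAlgClosed C]
    (v : AbsoluteValue K ℝ) (σ : K →+* C) (hσ : ∀ x, ‖σ x‖ = v x) :
    ∃ (n : ℕ) (w : Fin n → AbsoluteValue E ℝ), (∀ x, ∏ i, w i x = v (Algebra.norm K x)) ∧
      ∀ B : ℝ, ∃ B' : ℝ, ∀ x, (∀ i, w i x ≤ B) → ∀ j, v ((minpoly K x).coeff j) ≤ B' := by
  let : Algebra K C := σ.toAlgebra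
  set e := Fintype.equivFin (E →ₐ[K] C)
  -- Absolute values are indexed by embeddings, so that one may be repeated. This multiplicity is
  -- what turns their product into the norm.
  set w : (E →ₐ[K] C) → AbsoluteValue E ℝ := fun τ =>
    (NormedField.toAbsoluteValue C).comp (f := (τ : E →+* C)) τ.injective with hw
  have hwτ : ∀ τ x, w τ x = ‖τ x‖ := fun _ _ => rfl
  refine ⟨_, fun i => w (e.symm i), fun x => ?_, fun B => ?_⟩
  · rw [e.symm.prod_comp (fun τ => w τ x), ← hσ]
    change _ = ‖algebraMap K C _‖
    rw [Algebra.norm_eq_prod_embeddings, norm_prod]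
    rfl
  -- The coefficients are symmetric functions of the conjugates `τ x`, each of norm at most `B`.
  · refine ⟨max B 1 ^ Module.finrank K E * (Module.finrank K E).choose (Module.finrank K E / 2),
      fun x hx j => ?_⟩
    rw [← hσ, ← coeff_map]
    refine coeff_bdd_of_roots_le σ (minpoly.monic (Algebra.IsIntegral.isIntegral x))
      (IsAlgClosed.splits _) (minpoly.natDegree_le x) (fun z hz => ?_) j
    have hz' : z ∈ (minpoly K x).rootSet C := by
      rw [mem_rootSet_of_ne (minpoly.ne_zero (Algebra.IsIntegral.isIntegral x))]
      have := isRoot_of_mem_roots hz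
      rwa [IsRoot, eval_map] at this
    rw [← Algebra.IsAlgebraic.range_eval_eq_rootSet_minpoly C x] at hz'
    obtain ⟨τ, rfl⟩ := hz'
    have := hx (e τ)
    dsimp only at this
    rwa [Equiv.symm_apply_apply, hwτ] at this

theorem IsUltrametricOrComplex.exists_extensions {K : Type u} {E : Type*} [Field K] [Field E]
    [Algebra K E] [FiniteDimensional K E] [Algebra.IsSeparable K E]
    {v : AbsoluteValue K ℝ} (hv : v.IsUltrametricOrComplex) :
    ∃ (n : ℕ) (w : Fin n → AbsoluteValue E ℝ), (∀ x, ∏ i, w i x = v (Algebra.norm K x)) ∧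
      ∀ B : ℝ, ∃ B' : ℝ, ∀ x, (∀ i, w i x ≤ B) → ∀ j, v ((minpoly K x).coeff j) ≤ B' := by
  rcases hv with ⟨h1, h2⟩ | ⟨σ, hσ⟩
  · obtain ⟨C, _, _, σ, hσ⟩ := exists_isAlgClosed_of_isNonarchimedean v h1 h2
    exact exists_extensions_of_isAlgClosed v σ hσ
  · exact exists_extensions_of_isAlgClosed v σ hσ

end AbsoluteValue

/-! ### Passage to the global field and its rings of `S`-integers -/

/-- A finite extension embeds in a finite separable one by a power of the Frobenius map. -/
theorem exists_ringHom_separable (K F : Type*) [Field K] [Field F] [Algebra K F]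
    [FiniteDimensional K F] :
    ∃ (E : IntermediateField K F) (_ : Algebra.IsSeparable K E) (θ : F →+* E) (q : ℕ),
      ∀ x, (θ x : F) = x ^ q := by
  obtain ⟨p, hp⟩ := ExpChar.exists (separableClosure K F)
  exact ⟨separableClosure K F, inferInstance, IsPurelyInseparable.iterateFrobenius (separableClosure K F) F p le_rfl, _,
    IsPurelyInseparable.algebraMap_iterateFrobenius (separableClosure K F) p le_rfl⟩

/-- The ring of elements of `F` which are integral over `A[1/s]`. -/
def awayIntegers {A : Type*} [CommRing A] (F : Type*) [Field F] [Algebra A F] (s : A) :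
    Subring F where
  carrier := {x | ∃ n : ℕ, IsIntegral A (s ^ n • x)}
  zero_mem' := ⟨0, by simpa using isIntegral_zero⟩
  one_mem' := ⟨0, by simpa using isIntegral_one⟩
  add_mem' := by
    rintro x y ⟨n, hn⟩ ⟨m, hm⟩
    refine ⟨n + m, ?_⟩
    have := (hn.smul (s ^ m)).add (hm.smul (s ^ n))
    rwa [smul_smul, smul_smul, ← pow_add, ← pow_add, add_comm m n, ← smul_add] at this
  neg_mem' := by
    rintro x ⟨n, hn⟩
    exact ⟨n, by simpa using hn.neg⟩
  mul_mem' := by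
    rintro x y ⟨n, hn⟩ ⟨m, hm⟩
    refine ⟨n + m, ?_⟩
    have := hn.mul hm
    rwa [smul_mul_smul_comm, ← pow_add] at this

section awayIntegers

variable {A K F : Type*} [CommRing A] [Field K] [Field F] [Algebra A K] [IsFractionRing A K]
  [Algebra A F] [Algebra K F] [IsScalarTower A K F]

theorem awayIntegers_le_of_dvd {s t : A} (h : s ∣ t) : awayIntegers F s ≤ awayIntegers F t := by
  rintro x ⟨n, hn⟩
  obtain ⟨c, rfl⟩ := h
  refine ⟨n, ?_⟩
  rw [mul_pow, mul_comm, mul_smul]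
  exact hn.smul _

variable [FiniteDimensional K F]

/-- The minimal polynomial of `s ^ n • x` has coefficients in `A`, and it is that of `x` with roots
scaled by `s ^ n`. -/
theorem exists_coeff_minpoly [IsDomain A] [IsIntegrallyClosed A] {s : A} (hs : s ≠ 0) {x : F} {n : ℕ}
    (hx : IsIntegral A (s ^ n • x)) (j : ℕ) :
    ∃ m : ℕ, ∃ a : A, algebraMap A K s ^ m * (minpoly K x).coeff j = algebraMap A K a := by
  have h1 := IsIntegrallyClosed.minpoly_smul (R := K) (r := algebraMap A K (s ^ n)) (by simpa using fun h => absurd h hs)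
    (Algebra.IsIntegral.isIntegral (R := K) x)
  rw [algebraMap_smul, minpoly.isIntegrallyClosed_eq_field_fractions' K hx] at h1
  have h2 := congrArg (fun p => p.coeff j) h1
  rw [Polynomial.coeff_map, Polynomial.coeff_scaleRoots, map_pow, ← pow_mul, mul_comm] at h2
  exact ⟨_, _, h2.symm⟩

theorem exists_norm [IsDomain A] [IsIntegrallyClosed A] {s : A} {x : F} {n : ℕ}
    (hx : IsIntegral A (s ^ n • x)) :
    ∃ a : A, algebraMap A K s ^ (n * Module.finrank K F) * Algebra.norm K x = algebraMap A K a := by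
  obtain ⟨a, ha⟩ := IsIntegrallyClosed.isIntegral_iff.1 (Algebra.isIntegral_norm K hx)
  refine ⟨a, ?_⟩
  rw [ha, ← algebraMap_smul K, Algebra.smul_def, map_mul, Algebra.norm_algebraMap, map_pow, pow_mul]

end awayIntegers

/-- The absolute values are pulled back along `θ : F → E`, a power of Frobenius. They need not
extend those of `K`: it suffices that `θ` is injective and preserves integrality over `A[1/s]`. -/
theorem IsGlobalBase.exists_family {A : Type u} {F : Type*} (K : Type*) [CommRing A] [Field K]
    [Field F] [Algebra A K] [IsFractionRing A K] [Algebra A F] [Algebra K F] [IsScalarTower A K F]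
    [FiniteDimensional K F] (hA : IsGlobalBase A) {s : A} (hs : s ≠ 0) :
    ∃ (ι : Type u) (_ : Fintype ι) (v : ι → AbsoluteValue F ℝ),
      (∀ x ∈ awayIntegers F s, x⁻¹ ∈ awayIntegers F s → x ≠ 0 → ∏ i, v i x = 1) ∧
      ∀ B : ℝ, {x | x ∈ awayIntegers F s ∧ ∀ i, v i x ≤ B}.Finite := by
  have : IsDomain A := (IsFractionRing.injective A K).isDomain (algebraMap A K)
  have := hA.isPrincipalIdealRing
  obtain ⟨v₀, hv₀⟩ := hA.exists_isSize (K := K)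
  obtain ⟨ι, _, v, hext, hP, hN⟩ := hv₀.exists_family s hs
  obtain ⟨E, _, θ, q, hθ⟩ := exists_ringHom_separable K F
  have : IsScalarTower A E F := IsScalarTower.of_algebraMap_eq fun _ => rfl
  choose n w hw1 hw2 using fun i => (hext i).exists_extensions (E := E)
  have hmem : ∀ x : F, ∀ n : ℕ, IsIntegral A (s ^ n • x) →
      IsIntegral A (s ^ (n * q) • θ x) := by
    intro x n hx
    refine (isIntegral_algHom_iff (IsScalarTower.toAlgHom A E F)
      (algebraMap E F).injective).1 ?_
    have := hx.pow q
    rw [smul_pow, ← pow_mul, ← hθ] at this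
    rw [map_smul]
    exact this
  refine ⟨Σ i, Fin (n i), inferInstance, fun i => (w i.1 i.2).comp θ.injective, ?_, fun B => ?_⟩
  · rintro x ⟨a, ha⟩ ⟨b, hb⟩ hx
    rw [Fintype.prod_sigma]
    change ∏ i, ∏ j, w i j (θ x) = 1
    simp only [hw1]
    have hθ0 : θ x ≠ 0 := by simpa using hx
    have key : ∀ y : F, ∀ c d : ℕ, IsIntegral A (s ^ c • y) → c ≤ d →
        ∃ r, algebraMap A K s ^ (d * q * Module.finrank K E) * Algebra.norm K (θ y) =
          algebraMap A K r := by
      intro y c d hc hcd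
      refine exists_norm (hmem y d ?_)
      rw [← Nat.sub_add_cancel hcd, pow_add, mul_smul]
      exact hc.smul _
    refine hP _ _ (Algebra.norm_ne_zero_iff.2 hθ0) (key x a (a + b) ha (by omega)) ?_
    have := key _ b (a + b) hb (by omega)
    rwa [map_inv₀, eq_inv_of_mul_eq_one_left (a := Algebra.norm K (θ x)⁻¹) (by
      rw [← map_mul, inv_mul_cancel₀ hθ0, map_one])] at this
  · choose B' hB' using fun i => hw2 i B
    have hfin := hN (∑ i, |B' i|)
    set T := {x : K | (∃ n : ℕ, ∃ a, algebraMap A K s ^ n * x = algebraMap A K a) ∧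
        ∀ i, v i x ≤ ∑ i, |B' i|} with hT
    -- Northcott over `K` leaves finitely many minimal polynomials, each with finitely many roots.
    have hpoly : {p : Polynomial K | p.natDegree ≤ Module.finrank K E ∧ ∀ j, p.coeff j ∈ T}.Finite := by
      have hpi : {f : Fin (Module.finrank K E + 1) → K | ∀ i, f i ∈ T}.Finite :=
        Set.Finite.pi' fun _ => hfin
      refine Set.Finite.of_injOn (f := fun p (i : Fin (Module.finrank K E + 1)) => p.coeff i)
        (t := {f : Fin (Module.finrank K E + 1) → K | ∀ i, f i ∈ T})
        (fun p hp i => hp.2 i) (fun p hp p' hp' h => ?_) hpi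
      ext i
      by_cases hi : i < Module.finrank K E + 1
      · exact congrFun h ⟨i, hi⟩
      · rw [Polynomial.coeff_eq_zero_of_natDegree_lt (by have := hp.1; omega),
          Polynomial.coeff_eq_zero_of_natDegree_lt (by have := hp'.1; omega)]
    have hroots : {y : E | minpoly K y ∈ {p : Polynomial K |
        p.natDegree ≤ Module.finrank K E ∧ ∀ j, p.coeff j ∈ T}}.Finite := by
      refine Set.Finite.preimage' hpoly fun p _ => ?_
      by_cases h0 : p = 0
      · subst h0
        refine (Set.finite_empty).subset fun y hy => ?_
        exact minpoly.ne_zero (Algebra.IsIntegral.isIntegral (R := K) y) hy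
      · refine (p.rootSet_finite E).subset fun y hy => ?_
        rw [Polynomial.mem_rootSet_of_ne h0]
        have hy : minpoly K y = p := hy
        rw [← hy, minpoly.aeval]
    refine (hroots.preimage θ.injective.injOn).subset ?_
    rintro x ⟨⟨a, ha⟩, hx⟩
    refine ⟨minpoly.natDegree_le _, fun j => ⟨exists_coeff_minpoly hs (hmem x a ha) j, fun i => ?_⟩⟩
    refine (hB' i (θ x) (fun j => hx ⟨i, j⟩) j).trans ((le_abs_self _).trans ?_)
    exact Finset.single_le_sum (f := fun i => |B' i|) (fun i _ => abs_nonneg _) (Finset.mem_univ i)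

/-! ### Poles and reduction modulo a prime -/

section Integrality

open Polynomial

/-- A form of the `u, u⁻¹` lemma: the localization of an integrally closed domain at a prime is a
valuation ring, as far as the roots of primitive polynomials are concerned. -/
theorem exists_coordinates_of_aeval_eq_zero {R F : Type*} [CommRing R] [Field F] [Algebra R F]
    (hinj : Function.Injective (algebraMap R F))
    (hR : ∀ y : F, IsIntegral R y → ∃ r, algebraMap R F r = y) (𝔭 : Ideal R) [𝔭.IsPrime] (x : F)
    (n : ℕ) (p : R[X]) (hn : p.natDegree ≤ n) (hp : aeval x p = 0) (hi : ∃ i, p.coeff i ∉ 𝔭) :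
    ∃ a b : R, (a ∉ 𝔭 ∨ b ∉ 𝔭) ∧ x * algebraMap R F b = algebraMap R F a := by
  induction n generalizing p with
  | zero =>
    obtain ⟨i, hi⟩ := hi
    rw [eq_C_of_natDegree_le_zero hn] at hp hi
    rw [aeval_C, map_eq_zero_iff _ hinj] at hp
    simp [hp] at hi
  | succ n ih =>
    rcases hn.lt_or_eq with hlt | heq
    · exact ih p (by omega) hp hi
    obtain ⟨b, hb⟩ := hR _ (isIntegral_leadingCoeff_smul p x hp)
    have hb' : x * algebraMap R F p.leadingCoeff = algebraMap R F b := by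
      rw [hb, Algebra.smul_def, mul_comm]
    by_cases hc : p.leadingCoeff ∈ 𝔭
    swap
    · exact ⟨b, _, Or.inr hc, hb'⟩
    by_cases hb𝔭 : b ∈ 𝔭
    swap
    · exact ⟨b, _, Or.inl hb𝔭, hb'⟩
    -- With `c` the leading coefficient and `b = c x`, replace `c X^(n+1)` by `b X^n`. The root `x`
    -- survives and coefficients change only by elements of `𝔭`, so one still lies outside `𝔭`.
    refine ih (p.eraseLead + C b * X ^ n) ?_ ?_ ?_
    · refine natDegree_add_le_of_degree_le ?_ (natDegree_C_mul_X_pow_le b n)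
      have := eraseLead_natDegree_le p
      omega
    · have h1 := congrArg (aeval x) p.eraseLead_add_C_mul_X_pow
      rw [hp] at h1
      simp only [map_add, map_mul, map_pow, aeval_C, aeval_X, heq] at h1 ⊢
      rw [← hb', ← h1]
      ring
    · obtain ⟨i, hi⟩ := hi
      refine ⟨i, fun h => hi ?_⟩
      by_cases hin : i = p.natDegree
      · rwa [hin]
      rw [coeff_add, eraseLead_coeff_of_ne i hin, coeff_C_mul] at h
      exact (𝔭.add_mem_iff_left (𝔭.mul_mem_right _ hb𝔭)).1 h

variable {A F : Type*} [CommRing A] [IsDomain A] [IsPrincipalIdealRing A] [Field F] [Algebra A F]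

theorem exists_coordinates [Algebra.IsAlgebraic A F] [FaithfulSMul A F]
    (𝔭 : Ideal (integralClosure A F)) [𝔭.IsPrime] (x : F) :
    ∃ a b : integralClosure A F, (a ∉ 𝔭 ∨ b ∉ 𝔭) ∧ x * (b : F) = a := by
  obtain ⟨p, hp0, hp⟩ := Algebra.IsAlgebraic.isAlgebraic (R := A) x
  let := UniqueFactorizationMonoid.strongNormalizationMonoid (α := A)
  let := UniqueFactorizationMonoid.toNormalizedGCDMonoid A
  have hprim := p.isPrimitive_primPart
  have hroot := aeval_primPart_eq_zero hp0 hp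
  refine exists_coordinates_of_aeval_eq_zero (R := integralClosure A F) (F := F)
    Subtype.val_injective (fun y hy => ?_) 𝔭 x _ (p.primPart.map (algebraMap A _)) le_rfl
    (by rwa [aeval_map_algebraMap]) ?_
  · exact ⟨⟨y, isIntegral_trans y hy⟩, rfl⟩
  · by_contra! h
    -- If all coefficients lay in `𝔭`, a generator of the contraction `q` would divide the primitive
    -- polynomial, hence be a unit.
    set q := 𝔭.comap (algebraMap A (integralClosure A F)) with hq
    have hg := Ideal.span_singleton_generator q
    have hu : IsUnit (Submodule.IsPrincipal.generator q) := by
      refine hprim _ ((C_dvd_iff_dvd_coeff _ _).2 fun i => ?_)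
      rw [← Ideal.mem_span_singleton, Ideal.span_singleton_generator]
      have := h i
      rwa [coeff_map] at this
    have hqp : q.IsPrime := Ideal.comap_isPrime _ _
    exact hqp.ne_top (Ideal.eq_top_of_isUnit_mem _ (Submodule.IsPrincipal.generator_mem q) hu)

theorem exists_prime_of_notMem_awayIntegers [Algebra.IsAlgebraic A F] [FaithfulSMul A F] {s : A}
    {x : F} (hx : x ∉ awayIntegers F s) :
    ∃ (𝔭 : Ideal (integralClosure A F)) (_ : 𝔭.IsPrime), 𝔭 ≠ ⊥ ∧
      algebraMap A (integralClosure A F) s ∉ 𝔭 ∧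
      ∃ a b : integralClosure A F, a ∈ 𝔭 ∧ b ∉ 𝔭 ∧ x * (a : F) = b := by
  -- The ideal of denominators of `x`. It contains no power of `s`, so it lies in a prime avoiding
  -- `s`, and there the denominator of `x` vanishes.
  let I : Ideal (integralClosure A F) :=
    { carrier := {r | IsIntegral A (x * (r : F))}
      zero_mem' := by simpa using isIntegral_zero
      add_mem' := fun {r t} hr ht => by
        have := IsIntegral.add hr ht
        rwa [← mul_add] at this
      smul_mem' := fun c r hr => by
        have := IsIntegral.mul c.2 hr
        rwa [mul_left_comm] at this }
  have hI : ∀ r : integralClosure A F, r ∈ I ↔ IsIntegral A (x * (r : F)) := fun r => Iff.rfl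
  have hdisj : Disjoint (I : Set (integralClosure A F))
      (Submonoid.powers (algebraMap A (integralClosure A F) s)) := by
    rw [Set.disjoint_left]
    rintro _ hr ⟨n, rfl⟩
    refine hx ⟨n, ?_⟩
    have hr : IsIntegral A (x * ((algebraMap A (integralClosure A F) s ^ n :
      integralClosure A F) : F)) := hr
    rw [Algebra.smul_def, mul_comm, map_pow]
    exact hr
  obtain ⟨𝔭, h𝔭, hle, hs⟩ := Ideal.exists_le_prime_disjoint I _ hdisj
  obtain ⟨a, b, hab, hxab⟩ := exists_coordinates 𝔭 x
  have hb : b ∈ 𝔭 := hle ((hI b).2 (by rw [hxab]; exact a.2))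
  refine ⟨𝔭, h𝔭, fun h => ?_, fun h => Set.disjoint_left.1 hs h (Submonoid.mem_powers _), b, a, hb,
    hab.resolve_right (not_not.2 hb), hxab⟩
  obtain ⟨y, hy, hint⟩ := (Algebra.IsAlgebraic.isAlgebraic (R := A) x).exists_integral_multiple
  have : algebraMap A (integralClosure A F) y ∈ 𝔭 := hle ((hI _).2 (by
    rw [mul_comm]
    rwa [Algebra.smul_def] at hint))
  rw [h, Ideal.mem_bot] at this
  refine hy (FaithfulSMul.algebraMap_injective A F ?_)
  rw [map_zero]
  exact congrArg Subtype.val this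

/-- The point with affine coordinate `w` when `b` is placed at infinity. -/
theorem P1.chart_ne_zero {L : Type*} [Field L] (b w : L) : ![1 + b * w, w] ≠ 0 := by
  intro h
  have h1 := congrFun h 1
  have h0 := congrFun h 0
  simp only [Matrix.cons_val_one, Matrix.cons_val_zero, Pi.zero_apply, Matrix.cons_val_fin_one]
    at h0 h1
  simp [h1] at h0

/-- With `β = c / t` and `w = b / a`, the point is `[t a + c b : t b]`, which modulo `𝔭` becomes `[c
b : t b] = [c : t]`. -/
theorem congrMod_of_pole {R F : Type*} [CommRing R] [Field F] [Algebra R F]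
    (hinj : Function.Injective (algebraMap R F)) {β w : F} (𝔭 : Ideal R) [𝔭.IsPrime] {t c : R}
    (ht𝔭 : t ∉ 𝔭) (hcβ : algebraMap R F c = algebraMap R F t * β) {a b : R} (ha : a ∈ 𝔭)
    (hb : b ∉ 𝔭) (hw : w * algebraMap R F a = algebraMap R F b) :
    CongrMod 𝔭 (Projectivization.mk F ![1 + β * w, w] (P1.chart_ne_zero β w)) (P1.ofField β) := by
  have hne : ∀ r : R, r ∉ 𝔭 → algebraMap R 𝔭.ResidueField r ≠ 0 := fun r hr h =>
    hr (Ideal.algebraMap_residueField_eq_zero.1 h)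
  have hz : algebraMap R 𝔭.ResidueField a = 0 := Ideal.algebraMap_residueField_eq_zero.2 ha
  have hne' : ∀ r : R, r ∉ 𝔭 → algebraMap R F r ≠ 0 := fun r hr h =>
    hr (by rw [(map_eq_zero_iff _ hinj).1 h]; exact 𝔭.zero_mem)
  have hbt : t * b ∉ 𝔭 := fun h => (Ideal.IsPrime.mem_or_mem ‹_› h).elim ht𝔭 hb
  have ha0 : algebraMap R F a ≠ 0 := fun h => hne' b hb (by
    rw [← hw, h, mul_zero])
  refine ⟨Projectivization.mk _ (fun i => algebraMap R 𝔭.ResidueField ((![c, t] : Fin 2 → R) i))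
    (fun h => hne t ht𝔭 (congrFun h 1)), ⟨![t * a + c * b, t * b],
      fun h => hne' _ hbt (congrFun h 1), fun h => hne _ hbt (congrFun h 1), ?_, ?_⟩,
      ⟨![c, t], fun h => hne' _ ht𝔭 (congrFun h 1), fun h => hne _ ht𝔭 (congrFun h 1), ?_, rfl⟩⟩
  · rw [Projectivization.mk_eq_mk_iff']
    refine ⟨(algebraMap R F (t * a))⁻¹, ?_⟩
    have ht0 : (algebraMap R F t) ≠ 0 := hne' t ht𝔭
    ext i
    fin_cases i
    · change (algebraMap R F (t * a))⁻¹ * (algebraMap R F (t * a + c * b)) = 1 + β * w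
      rw [map_add, map_mul, map_mul, hcβ, ← hw]
      field_simp
    · change (algebraMap R F (t * a))⁻¹ * (algebraMap R F (t * b)) = w
      rw [map_mul, map_mul, ← hw]
      field_simp
  · rw [Projectivization.mk_eq_mk_iff']
    refine ⟨(algebraMap R 𝔭.ResidueField b)⁻¹, ?_⟩
    have hb0 := hne b hb
    ext i
    fin_cases i
    · change (algebraMap R 𝔭.ResidueField b)⁻¹ * algebraMap R 𝔭.ResidueField (t * a + c * b) =
        algebraMap R 𝔭.ResidueField c
      rw [map_add, map_mul, map_mul, hz]
      field_simp
      ring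
    · change (algebraMap R 𝔭.ResidueField b)⁻¹ * algebraMap R 𝔭.ResidueField (t * b) =
        algebraMap R 𝔭.ResidueField t
      rw [map_mul]
      field_simp
  · rw [P1.ofField, Projectivization.mk_eq_mk_iff']
    refine ⟨(algebraMap R F t)⁻¹, ?_⟩
    have ht0 : (algebraMap R F t) ≠ 0 := hne' t ht𝔭
    ext i
    fin_cases i
    · change (algebraMap R F t)⁻¹ * (algebraMap R F c) = β
      rw [hcβ]
      field_simp
    · change (algebraMap R F t)⁻¹ * (algebraMap R F t) = 1
      field_simp

end Integrality

theorem P1.exists_chart {L : Type*} [Field L] (b : L) (P : P1 L) (hP : P ≠ P1.ofField b) :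
    ∃ w, P = Projectivization.mk L ![1 + b * w, w] (P1.chart_ne_zero b w) := by
  induction P using Projectivization.ind with | h v hv =>
  by_cases h : v 0 - b * v 1 = 0
  · refine absurd ?_ hP
    rw [P1.ofField, Projectivization.mk_eq_mk_iff']
    refine ⟨v 1, ?_⟩
    ext i
    fin_cases i
    · simp only [Fin.zero_eta, Pi.smul_apply, Matrix.cons_val_zero, smul_eq_mul]
      linear_combination -h
    · simp
  · refine ⟨v 1 / (v 0 - b * v 1), ?_⟩
    rw [Projectivization.mk_eq_mk_iff']
    refine ⟨v 0 - b * v 1, ?_⟩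
    ext i
    fin_cases i
    · simp only [Fin.zero_eta, Pi.smul_apply, Matrix.cons_val_zero, smul_eq_mul]
      field_simp
      ring
    · simp only [Fin.mk_one, Pi.smul_apply, Matrix.cons_val_one, Matrix.cons_val_fin_one,
        smul_eq_mul]
      field_simp

/-! ### Iterates in the coordinate with `β` at infinity -/

namespace RationalMap

open Polynomial

variable {F : Type*} [Field F] (φ : RatFunc F)

/-- The homogeneous coordinates of `φⁿ([1 + β w : w])`, as polynomials in `w`. -/
noncomputable def iterPair (β : F) : ℕ → Fin 2 → F[X]
  | 0 => ![1 + C β * X, X]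
  | n + 1 => ![MvPolynomial.aeval (iterPair β n) (φ.num.homogenize (degree φ)),
      MvPolynomial.aeval (iterPair β n) (φ.denom.homogenize (degree φ))]

theorem aeval_iterPair (β : F) {L : Type*} [Field L] [Algebra F L] (w : L) (n : ℕ) :
    (fun i => aeval w (iterPair φ β n i)) = (forms φ L)^[n] ![1 + algebraMap F L β * w, w] := by
  induction n with
  | zero =>
    ext i
    fin_cases i <;> simp [iterPair]
  | succ n ih =>
    rw [Function.iterate_succ_apply', ← ih]
    ext i
    fin_cases i
    · exact MvPolynomial.comp_aeval_apply (iterPair φ β n) (aeval w) _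
    · exact MvPolynomial.comp_aeval_apply (iterPair φ β n) (aeval w) _

theorem iterate_forms_ne_zero {L : Type*} [Field L] [Algebra F L] (n : ℕ) {v : Fin 2 → L}
    (hv : v ≠ 0) : (forms φ L)^[n] v ≠ 0 := by
  induction n with
  | zero => exact hv
  | succ n ih =>
    rw [Function.iterate_succ_apply']
    exact forms_ne_zero φ _ ih

theorem iterate_map_mk {L : Type*} [Field L] [Algebra F L] (n : ℕ) {v : Fin 2 → L} (hv : v ≠ 0) :
    (map φ L)^[n] (Projectivization.mk L v hv) =
      Projectivization.mk L ((forms φ L)^[n] v) (iterate_forms_ne_zero φ n hv) := by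
  induction n with
  | zero => rfl
  | succ n ih =>
    simp only [Function.iterate_succ_apply']
    rw [ih]
    rfl

theorem aeval_homogenize (p : F[X]) (d : ℕ) {S : Type*} [CommRing S] [Algebra F S]
    (f : Fin 2 → S) : MvPolynomial.aeval f (p.homogenize d) =
      ∑ kl ∈ Finset.HasAntidiagonal.antidiagonal d, algebraMap F S (p.coeff kl.1) * (f 0 ^ kl.1 * f 1 ^ kl.2) := by
  simp only [Polynomial.homogenize, map_sum]
  refine Finset.sum_congr rfl fun kl hkl => ?_
  rw [MvPolynomial.aeval_monomial, Finsupp.prod_fintype _ _ (by simp)]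
  simp [Fin.prod_univ_two]

theorem natDegree_aeval_homogenize_le (p : F[X]) (d N : ℕ) (f : Fin 2 → F[X])
    (hf : ∀ i, (f i).natDegree ≤ N) :
    (MvPolynomial.aeval f (p.homogenize d)).natDegree ≤ N * d := by
  rw [aeval_homogenize]
  refine natDegree_sum_le_of_forall_le _ _ fun kl hkl => ?_
  have h := Finset.HasAntidiagonal.mem_antidiagonal.1 hkl
  refine (natDegree_C_mul_le _ _).trans (natDegree_mul_le.trans ?_)
  have h0 := natDegree_pow_le_of_le kl.1 (hf 0)
  have h1 := natDegree_pow_le_of_le kl.2 (hf 1)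
  rw [← h, mul_add, mul_comm N, mul_comm N]
  omega

theorem coeff_aeval_homogenize (p : F[X]) (d N : ℕ) (f : Fin 2 → F[X])
    (hf : ∀ i, (f i).natDegree ≤ N) :
    (MvPolynomial.aeval f (p.homogenize d)).coeff (N * d) =
      MvPolynomial.aeval (fun i => (f i).coeff N) (p.homogenize d) := by
  rw [aeval_homogenize, aeval_homogenize, finsetSum_coeff]
  refine Finset.sum_congr rfl fun kl hkl => ?_
  have h := Finset.HasAntidiagonal.mem_antidiagonal.1 hkl
  change (C _ * _).coeff _ = _
  rw [coeff_C_mul, ← h, mul_add, mul_comm N, mul_comm N,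
    coeff_mul_add_eq_of_natDegree_le (natDegree_pow_le_of_le kl.1 (hf 0))
      (natDegree_pow_le_of_le kl.2 (hf 1)), coeff_pow_of_natDegree_le (hf 0),
    coeff_pow_of_natDegree_le (hf 1)]
  rfl

theorem natDegree_iterPair_le (β : F) (n : ℕ) (i : Fin 2) :
    (iterPair φ β n i).natDegree ≤ degree φ ^ n := by
  induction n generalizing i with
  | zero =>
    fin_cases i
    · simp only [iterPair, Fin.zero_eta, Matrix.cons_val_zero, pow_zero]
      compute_degree
    · simp [iterPair]
  | succ n ih =>
    fin_cases i
    · exact natDegree_aeval_homogenize_le _ _ _ _ ih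
    · exact natDegree_aeval_homogenize_le _ _ _ _ ih

/-- The coefficients in the formal top degree are the value at `w = ∞`, the point `[β : 1]`. -/
theorem coeff_iterPair (β : F) (n : ℕ) :
    (fun i => (iterPair φ β n i).coeff (degree φ ^ n)) = (forms φ F)^[n] ![β, 1] := by
  induction n with
  | zero =>
    ext i
    fin_cases i <;> simp [iterPair, coeff_one]
  | succ n ih =>
    rw [Function.iterate_succ_apply', ← ih]
    ext i
    fin_cases i
    · exact coeff_aeval_homogenize _ _ _ _ (natDegree_iterPair_le φ β n)
    · exact coeff_aeval_homogenize _ _ _ _ (natDegree_iterPair_le φ β n)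

/-- A common root over the algebraic closure would make the iterated forms vanish at a nonzero
vector. -/
theorem isCoprime_iterPair (β : F) (n : ℕ) :
    IsCoprime (iterPair φ β n 0) (iterPair φ β n 1) := by
  rw [isCoprime_iff_aeval_ne_zero_of_isAlgClosed F (AlgebraicClosure F)]
  intro w
  by_contra! h
  refine iterate_forms_ne_zero φ n (P1.chart_ne_zero (algebraMap F (AlgebraicClosure F) β) w) ?_
  rw [← aeval_iterPair]
  ext i
  fin_cases i
  · exact h.1
  · exact h.2

/-- The polynomial whose roots are the preimages of `β` under `φⁿ` other than `β`. -/
noncomputable def polePoly (β : F) (n : ℕ) : F[X] := iterPair φ β n 0 - C β * iterPair φ β n 1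

theorem isCoprime_polePoly (β : F) (n : ℕ) :
    IsCoprime (iterPair φ β n 1) (polePoly φ β n) := by
  obtain ⟨u, v, h⟩ := isCoprime_iterPair φ β n
  exact ⟨v + u * C β, u, by rw [polePoly, ← h]; ring⟩

theorem polePoly_ne_zero (hφ : 1 ≤ degree φ) (β : F) (n : ℕ) : polePoly φ β n ≠ 0 := by
  intro h
  have hu : IsUnit (iterPair φ β n 1) := by
    have := isCoprime_polePoly φ β n
    rwa [h, isCoprime_zero_right] at this
  have hd := natDegree_eq_zero_of_isUnit hu
  have h1 : (iterPair φ β n 1).coeff (degree φ ^ n) = 0 :=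
    coeff_eq_zero_of_natDegree_lt (by rw [hd]; positivity)
  have h0 : (iterPair φ β n 0).coeff (degree φ ^ n) = 0 := by
    rw [polePoly, sub_eq_zero] at h
    rw [h, coeff_C_mul, h1, mul_zero]
  refine iterate_forms_ne_zero φ n (v := ![β, 1]) (fun h => one_ne_zero (congrFun h 1)) ?_
  rw [← coeff_iterPair]
  ext i
  fin_cases i
  · exact h0
  · exact h1

theorem aeval_polePoly_eq_zero (β : F) (n : ℕ) {L : Type*} [Field L] [Algebra F L] (w : L)
    (h : (map φ L)^[n] (Projectivization.mk L _ (P1.chart_ne_zero (algebraMap F L β) w)) =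
      P1.ofField (algebraMap F L β)) : aeval w (polePoly φ β n) = 0 := by
  rw [iterate_map_mk, P1.ofField, Projectivization.mk_eq_mk_iff'] at h
  obtain ⟨t, ht⟩ := h
  rw [← aeval_iterPair] at ht
  have h0 := congrFun ht 0
  have h1 := congrFun ht 1
  simp only [Pi.smul_apply, Matrix.cons_val_zero, Matrix.cons_val_one, Matrix.cons_val_fin_one,
    smul_eq_mul, mul_one] at h0 h1
  rw [polePoly, map_sub, map_mul, aeval_C, ← h0, ← h1]
  ring

theorem finite_fiber (hφ : 1 ≤ degree φ) (β : F) (n : ℕ) (L : Type*) [Field L] [Algebra F L] :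
    {Q | (map φ L)^[n] Q = P1.ofField (algebraMap F L β)}.Finite := by
  refine (((((polePoly φ β n).rootSet_finite L).image fun w => Projectivization.mk L _
    (P1.chart_ne_zero (algebraMap F L β) w))).insert (P1.ofField (algebraMap F L β))).subset ?_
  intro Q hQ
  by_cases h : Q = P1.ofField (algebraMap F L β)
  · exact Or.inl h
  · obtain ⟨w, rfl⟩ := P1.exists_chart _ _ h
    refine Or.inr ⟨w, ?_, rfl⟩
    rw [mem_rootSet_of_ne (polePoly_ne_zero φ hφ β n)]
    exact aeval_polePoly_eq_zero φ β n w hQ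

/-- If the polynomial is constant, `β` is its own only preimage under `φ^k`; the back orbit then
lies in the fibres of `φ^r` for `r < k`, which are finite. -/
theorem natDegree_polePoly_pos (hφ : 1 ≤ degree φ) {β : F} {k : ℕ} (hk : 1 ≤ k)
    (hβ : ¬ IsExceptional φ β) : 1 ≤ (polePoly φ β k).natDegree := by
  by_contra! hd
  have hC := eq_C_of_natDegree_eq_zero (by omega : (polePoly φ β k).natDegree = 0)
  set L := AlgebraicClosure F
  set b : L := algebraMap F L β
  have hfix : ∀ Q, (map φ L)^[k] Q = P1.ofField b → Q = P1.ofField b := by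
    intro Q hQ
    by_contra h
    obtain ⟨w, rfl⟩ := P1.exists_chart _ _ h
    have h0 := aeval_polePoly_eq_zero φ β k w hQ
    rw [hC, aeval_C, map_eq_zero] at h0
    exact polePoly_ne_zero φ hφ β k (by rw [hC, h0, C_0])
  have hfix' : ∀ m Q, (map φ L)^[k * m] Q = P1.ofField b → Q = P1.ofField b := by
    intro m
    induction m with
    | zero => exact fun Q hQ => hQ
    | succ m ih =>
      intro Q hQ
      rw [mul_add, mul_one, Function.iterate_add_apply] at hQ
      exact hfix Q (ih _ hQ)
  refine hβ (((Set.finite_lt_nat k).biUnion fun r _ => finite_fiber φ hφ β r L).subset ?_)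
  rintro Q ⟨n, -, hn⟩
  refine Set.mem_biUnion (Nat.mod_lt n hk) ?_
  rw [← Nat.div_add_mod n k, Function.iterate_add_apply] at hn
  exact hfix' _ _ hn

/-- Since `φ^k` fixes `β`, the top coefficients are a nonzero multiple of `(β, 1)`: the second is
nonzero, and the combination defining `polePoly` cancels. -/
theorem natDegree_of_isPeriodicPt (hφ : 1 ≤ degree φ) {β : F} {k : ℕ}
    (hk : (map φ F)^[k] (P1.ofField β) = P1.ofField β) :
    (iterPair φ β k 1).natDegree = degree φ ^ k ∧ (polePoly φ β k).natDegree < degree φ ^ k := by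
  have hne : ![β, 1] ≠ 0 := fun h => one_ne_zero (congrFun h 1)
  have h := hk
  rw [P1.ofField, iterate_map_mk, Projectivization.mk_eq_mk_iff'] at h
  obtain ⟨t, ht⟩ := h
  have ht0 : t ≠ 0 := by
    rintro rfl
    exact iterate_forms_ne_zero φ k hne (by rw [← ht, zero_smul])
  rw [← coeff_iterPair] at ht
  have h0 := congrFun ht 0
  have h1 := congrFun ht 1
  simp only [Pi.smul_apply, Matrix.cons_val_zero, Matrix.cons_val_one, Matrix.cons_val_fin_one,
    smul_eq_mul, mul_one] at h0 h1
  refine ⟨natDegree_eq_of_le_of_coeff_ne_zero (natDegree_iterPair_le φ β k 1) (h1 ▸ ht0), ?_⟩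
  have hle : (polePoly φ β k).natDegree ≤ degree φ ^ k :=
    (natDegree_sub_le _ _).trans (max_le (natDegree_iterPair_le φ β k 0)
      ((natDegree_C_mul_le _ _).trans (natDegree_iterPair_le φ β k 1)))
  refine lt_of_le_of_ne hle fun h => polePoly_ne_zero φ hφ β k ?_
  rw [← leadingCoeff_eq_zero, leadingCoeff, h, polePoly, coeff_sub, coeff_C_mul, ← h0, ← h1]
  ring

theorem mul_eval_polePoly {β : F} {k : ℕ} {w w' : F}
    (h : (map φ F)^[k] (Projectivization.mk F _ (P1.chart_ne_zero β w)) =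
      Projectivization.mk F _ (P1.chart_ne_zero β w')) :
    w' * (polePoly φ β k).eval w = (iterPair φ β k 1).eval w := by
  rw [iterate_map_mk, Projectivization.mk_eq_mk_iff'] at h
  obtain ⟨t, ht⟩ := h
  have he := aeval_iterPair φ β w k
  rw [Algebra.algebraMap_self, RingHom.id_apply] at he
  rw [← he] at ht
  have h0 := congrFun ht 0
  have h1 := congrFun ht 1
  simp only [Pi.smul_apply, Matrix.cons_val_zero, Matrix.cons_val_one, Matrix.cons_val_fin_one,
    smul_eq_mul, coe_aeval_eq_eval] at h0 h1
  rw [polePoly, eval_sub, eval_mul, eval_C, ← h0, ← h1]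
  ring

theorem IsWandering.injective {φ : RatFunc F} {α : F} (hα : IsWandering φ α) :
    Function.Injective fun n => (map φ F)^[n] (P1.ofField α) := by
  by_contra h
  obtain ⟨m, n, hmn, hlt⟩ : ∃ m n, (map φ F)^[m] (P1.ofField α) = (map φ F)^[n] (P1.ofField α) ∧
      m < n := by
    rw [Function.Injective] at h
    push Not at h
    obtain ⟨m, n, h1, h2⟩ := h
    rcases lt_or_gt_of_ne h2 with h3 | h3
    · exact ⟨m, n, h1, h3⟩
    · exact ⟨n, m, h1.symm, h3⟩
  refine hα (((Set.finite_lt_nat n).image fun i => (map φ F)^[i] (P1.ofField α)).subset ?_)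
  rintro _ ⟨i, rfl⟩
  induction i using Nat.strong_induction_on with
  | _ i ih =>
    by_cases hi : i < n
    · exact ⟨i, hi, rfl⟩
    · have : (map φ F)^[i] (P1.ofField α) = (map φ F)^[i - n + m] (P1.ofField α) := by
        rw [Function.iterate_add_apply, hmn, ← Function.iterate_add_apply,
          Nat.sub_add_cancel (by omega)]
      rw [this]
      exact ih _ (by omega)

end RationalMap

/-! ### Conclusion -/

theorem mainTheorem9 {A K F : Type*} [CommRing A] [Field K] [Field F]
    [Algebra A K] [IsFractionRing A K] [Algebra A F] [Algebra K F] [IsScalarTower A K F]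
    [FiniteDimensional K F] (hA : IsGlobalBase A)
    (φ : RatFunc F) (hφ : 2 ≤ RationalMap.degree φ) (α β : F)
    (hα : RationalMap.IsWandering φ α)
    (hβ : RationalMap.IsPeriodic φ β) (hβ' : ¬ RationalMap.IsExceptional φ β) :
    {𝔭 : PrimeSpectrum (integralClosure A F) | 𝔭.asIdeal ≠ ⊥ ∧
      ∃ n : ℕ, CongrMod 𝔭.asIdeal
        ((RationalMap.map φ F)^[n] (P1.ofField α)) (P1.ofField β)}.Infinite := by
  classical
  intro hfin
  have : IsDomain A := (IsFractionRing.injective A K).isDomain (algebraMap A K)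
  have := hA.isPrincipalIdealRing
  have : FaithfulSMul A F := by
    rw [faithfulSMul_iff_algebraMap_injective, IsScalarTower.algebraMap_eq A K F]
    exact (algebraMap K F).injective.comp (IsFractionRing.injective A K)
  have : Algebra.IsAlgebraic A F :=
    (IsFractionRing.comap_isAlgebraic_iff (A := A) (K := K) (C := F)).2 inferInstance
  obtain ⟨k, hk, hkβ⟩ := hβ
  set f := RationalMap.iterPair φ β k 1
  set g := RationalMap.polePoly φ β k
  obtain ⟨u, w, hfg⟩ : ∃ u w, u * f + w * g = 1 := RationalMap.isCoprime_polePoly φ β k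
  obtain ⟨hfd, hgd⟩ := RationalMap.natDegree_of_isPeriodicPt φ (by omega) hkβ
  have hgd1 : 1 ≤ g.natDegree := RationalMap.natDegree_polePoly_pos φ (by omega) hk hβ'
  have hinj := hα.injective
  -- Hitting `β` would make the orbit periodic from there on, so every orbit point has a finite
  -- coordinate.
  have hne : ∀ n, (RationalMap.map φ F)^[n] (P1.ofField α) ≠ P1.ofField β := by
    intro n hn
    have h : (RationalMap.map φ F)^[k + n] (P1.ofField α) =
        (RationalMap.map φ F)^[n] (P1.ofField α) := by
      rw [Function.iterate_add_apply, hn, hkβ]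
    have := hinj h
    omega
  choose a ha using fun n => P1.exists_chart β _ (hne (k * n))
  have ha_inj : Function.Injective a := by
    intro m n hmn
    have h : (RationalMap.map φ F)^[k * m] (P1.ofField α) =
        (RationalMap.map φ F)^[k * n] (P1.ofField α) := by
      rw [ha m, ha n]
      simp only [hmn]
    exact Nat.eq_of_mul_eq_mul_left (by omega) (hinj h)
  have hrec : ∀ n, a (n + 1) * g.eval (a n) = f.eval (a n) := by
    intro n
    refine RationalMap.mul_eval_polePoly φ ?_
    rw [← ha, ← ha, mul_add, mul_one, add_comm, Function.iterate_add_apply]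
  -- a common denominator lying in all the primes of the finite set
  obtain ⟨s₁, hs₁, hint⟩ := Algebra.IsAlgebraic.exists_integral_multiples A
    (insert β (g.coeffs ∪ u.coeffs ∪ w.coeffs))
  have hprime : ∀ 𝔭 : PrimeSpectrum (integralClosure A F), ∃ r : A, r ≠ 0 ∧
      (𝔭.asIdeal ≠ ⊥ → algebraMap A (integralClosure A F) r ∈ 𝔭.asIdeal) := by
    intro 𝔭
    by_cases h : 𝔭.asIdeal = ⊥
    · exact ⟨1, one_ne_zero, fun h' => absurd h h'⟩
    · have := Ideal.IsIntegral.comap_ne_bot (R := A) h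
      obtain ⟨r, hr, hr0⟩ := Submodule.exists_mem_ne_zero_of_ne_bot this
      exact ⟨r, hr0, fun _ => hr⟩
  choose r hr0 hr using hprime
  set s : A := s₁ * ∏ 𝔭 ∈ hfin.toFinset, r 𝔭
  have hs : s ≠ 0 := mul_ne_zero hs₁ (Finset.prod_ne_zero_iff.2 fun 𝔭 _ => hr0 𝔭)
  have hmem : ∀ x ∈ insert β (g.coeffs ∪ u.coeffs ∪ w.coeffs), x ∈ awayIntegers F s :=
    fun x hx => awayIntegers_le_of_dvd (dvd_mul_right _ _) ⟨1, by rw [pow_one]; exact hint x hx⟩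
  have hcoeff : ∀ p : Polynomial F, p.coeffs ⊆ g.coeffs ∪ u.coeffs ∪ w.coeffs →
      ∀ n, p.coeff n ∈ awayIntegers F s := by
    intro p hp n
    by_cases h : p.coeff n = 0
    · rw [h]; exact zero_mem _
    · exact hmem _ (Finset.mem_insert_of_mem (hp (Polynomial.coeff_mem_coeffs h)))
  -- A failure yields a pole at a prime not containing `s`. By reduction that prime belongs to the
  -- finite set, all of whose members contain `s`.
  have haO : ∀ n, a n ∈ awayIntegers F s := by
    intro n
    by_contra hn
    obtain ⟨𝔭, h𝔭, hbot, hs𝔭, x, y, hx, hy, hxy⟩ := exists_prime_of_notMem_awayIntegers hn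
    obtain ⟨m, hm⟩ := hmem β (Finset.mem_insert_self _ _)
    have hcong := congrMod_of_pole (β := β) Subtype.val_injective 𝔭
      (t := algebraMap A (integralClosure A F) s ^ m) (c := ⟨s ^ m • β, hm⟩)
      (fun h => hs𝔭 (h𝔭.mem_of_pow_mem _ h))
      (by
        rw [map_pow, ← IsScalarTower.algebraMap_apply, ← map_pow, ← Algebra.smul_def]
        rfl) hx hy hxy
    rw [← ha] at hcong
    have hT : (⟨𝔭, h𝔭⟩ : PrimeSpectrum (integralClosure A F)) ∈ hfin.toFinset :=
      hfin.mem_toFinset.2 ⟨hbot, _, hcong⟩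
    refine hs𝔭 (Ideal.mem_of_dvd _ (map_dvd (algebraMap A (integralClosure A F))
      ((Finset.dvd_prod_of_mem r hT).trans (dvd_mul_left _ s₁))) (hr ⟨𝔭, h𝔭⟩ hbot))
  obtain ⟨ι, _, v, hP, hN⟩ := hA.exists_family K (F := F) hs
  exact AbsoluteValue.not_injective_of_mem_subring (awayIntegers F s) v hP hN hfg
    (hcoeff g (by grind)) (hcoeff u (by grind)) (hcoeff w (by grind))
    hgd1 (by rw [hfd]; exact hgd) a haO hrec ha_inj
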